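/- Let $[m]=\{1,\dots,m\}$. A family $\mathcal G\subset 2^{[n]}$ is $3$-wise $t$-intersecting if $|A\cap B\cap C|\ge t$ for all (not necessarily distinct) $A,B,C\in\mathcal G$, and it is $(3,t)$-maximal if moreover $\mathcal G\cup\{F\}$ is not $3$-wise $t$-intersecting for any $F\in 2^{[n]}\setminus\mathcal G$. For $0<p<1$ let $\mu_p(\mathcal G)=\sum_{G\in\mathcal G}p^{|G|}(1-p)^{n-|G|}$. For $i\ge0$ with $t+3i\le n$ let $\mathcal F_i^t=\{F\subset[n]:|F\cap[t+3i]|\ge t+2i\}$. Two families in $2^{[n]}$ are isomorphic if a permutation of $[n]$ carries one to the other. For $1\le i<j\le n$ the shift $\sigma_{i,j}(\mathcal G)$ is obtained from $\mathcal G$ by replacing each $G\in\mathcal G$ with $G\cap\{i,j\}=\{j\}$ and $G':=(G\setminus\{j\})\cup\{i\}\notin\mathcal G$ by $G'$ and keeping all other members; $\mathcal G$ is shifted if $\sigma_{i,j}(\mathcal G)=\mathcal G$ for all $i<j$. A shifted family $\mathcal H$ is obtained from $\mathcal G$ by shifting if it results from $\mathcal G$ by finitely many such shifts. Let $p_0(t)=\frac{2}{\sqrt{4t+9}-1}$.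 **Proposition.** There is a function $t_0:\mathbb R\to\mathbb N$ such that the following holds for all integers $t\ge 241$ and $n\ge0$ and all real $p$ with $0<p\le p_0(t)$. If $\mathcal G\subset 2^{[n]}$ is a $3$-wise $t$-intersecting family, then at least one of the following holds. (i) $\mu_p(\mathcal G)<\frac12p^t$. (ii) $\mathcal G\subset\mathcal F$ for some $\mathcal F$ isomorphic to $\mathcal F_0^t$ (with $t\le n$) or to $\mathcal F_1^t$ (with $t+3\le n$). (iii) $t+6\le n$ and there is a $(3,t)$-maximal family $\tilde{\mathcal G}\subset 2^{[n]}$ with $\mathcal G\subset\tilde{\mathcal G}$ and a shifted family $\mathcal H$ obtained from $\tilde{\mathcal G}$ by shifting such that $\mathcal H\subset\mathcal F_2^t$; moreover, for every $\delta>0$, if $t>t_0(\delta)$ then $\mu_p(\mathcal G)<(\frac12+\delta)p^t$. -/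

import Mathlib

namespace ThreeWise

/-- `𝒢 ⊆ 2^[n]` is `3`-wise `t`-intersecting. The ground set `[n]` is modelled by `Fin n`,
its element `k` being the member of `Fin n` with value `k - 1`. -/
def IsThreeWise {n : ℕ} (t : ℕ) (𝒢 : Finset (Finset (Fin n))) : Prop :=
  ∀ A ∈ 𝒢, ∀ B ∈ 𝒢, ∀ C ∈ 𝒢, t ≤ (A ∩ B ∩ C).card

/-- The `p`-biased measure of a family of subsets of `[n]`. -/
noncomputable def mu {n : ℕ} (p : ℝ) (𝒢 : Finset (Finset (Fin n))) : ℝ :=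
  ∑ G ∈ 𝒢, p ^ G.card * (1 - p) ^ (n - G.card)

/-- The initial segment `[m] ∩ [n]` of the ground set `[n]`. -/
def seg (n m : ℕ) : Finset (Fin n) :=
  Finset.univ.filter fun x => x.val < m

/-- The family `𝓕_i^t = {F ⊆ [n] : |F ∩ [t + 3i]| ≥ t + 2i}` (meant for `t + 3i ≤ n`). -/
def fam (n t i : ℕ) : Finset (Finset (Fin n)) :=
  Finset.univ.filter fun F => t + 2 * i ≤ (F ∩ seg n (t + 3 * i)).card

/-- Two families are isomorphic if a permutation of the ground set carries one to the other. -/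
def Iso {n : ℕ} (𝒢 ℋ : Finset (Finset (Fin n))) : Prop :=
  ∃ τ : Equiv.Perm (Fin n), ℋ = 𝒢.image fun G => G.image τ

/-- The threshold `p₀(t) = 2 / (√(4t+9) - 1)`. -/
noncomputable def p₀ (t : ℕ) : ℝ := 2 / (Real.sqrt (4 * t + 9) - 1)

/-- The map `s_{i,j}` on sets, relative to the family `𝒢`. -/
def shiftSet {n : ℕ} (𝒢 : Finset (Finset (Fin n))) (i j : Fin n) (G : Finset (Fin n)) :
    Finset (Fin n) :=
  if G ∩ {i, j} = {j} ∧ (G \ {j}) ∪ {i} ∉ 𝒢 then (G \ {j}) ∪ {i} else G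

/-- The shifting operation `σ_{i,j}`. -/
def shift {n : ℕ} (i j : Fin n) (𝒢 : Finset (Finset (Fin n))) : Finset (Finset (Fin n)) :=
  𝒢.image (shiftSet 𝒢 i j)

/-- A family is shifted if it is invariant under all `σ_{i,j}` with `i < j`. -/
def IsShifted {n : ℕ} (𝒢 : Finset (Finset (Fin n))) : Prop :=
  ∀ i j : Fin n, i < j → shift i j 𝒢 = 𝒢

/-- `ℋ` is a shifted family obtained from `𝒢` by finitely many shifting operations
`σ_{i,j}` with `i < j`. -/
def ObtainedByShifting {n : ℕ} (𝒢 ℋ : Finset (Finset (Fin n))) : Prop :=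
  Relation.ReflTransGen (fun 𝒜 ℬ => ∃ i j : Fin n, i < j ∧ ℬ = shift i j 𝒜) 𝒢 ℋ ∧ IsShifted ℋ

/-- `𝒢` is `(3,t)`-maximal: it is `3`-wise `t`-intersecting and no further set can be added. -/
def IsMaximal {n : ℕ} (t : ℕ) (𝒢 : Finset (Finset (Fin n))) : Prop :=
  IsThreeWise t 𝒢 ∧ ∀ F : Finset (Fin n), F ∉ 𝒢 → ¬ IsThreeWise t (insert F 𝒢)

end ThreeWise

namespace ThreeWise
open Finset

/-! ### Biased measure and cross-intersecting families -/

section Biased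

variable {α : Type*}

/-! Enlarge the family to a maximal one, which is an up-set, and shift it to a stable family `ℋ`.
Being 3-wise `t`-intersecting, being an up-set and the measure all survive. Read a set as a lattice
walk, an element being a step up and a missing one a step to the right. A shifted up-set contains
every set that dominates a member, so a walk in `ℋ` avoiding the line `y = 2x + t` would put into
`ℋ` three sets meeting in only `t - 1` points (`exists_hit`). Hence each member misses exactly `i`
elements of `[t + 3i]` for some `i`, and part `i` has measure at most `C(t+3i, i) v^i p^t` with `v =
p²(1-p)`. The threshold on `p` gives `(t + 2) v ≤ 1`, so part `i` weighs about `p^t / i!` at most.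

These bounds alone sum to too much; the gain is in `i = 0, 1, 2`. If `ℋ` is not inside `𝓕_i^t`, it
contains the complement of the last `i + 1` elements of `[t + 3i]`. Against this third set, two
members of part `i` with disjoint missing sets have to meet outside `[t + 3i]`. Their links are thus
cross-intersecting, and one of them has measure at most `3/40` (`prob_min_of_cross`). The missing
sets with heavy links form an intersecting family, whose contribution is negligible, and the total
drops below `p^t / 2` (`mu_lt_of_shifted`).

If `ℋ ⊆ 𝓕_2^t`, a union bound gives the estimate with `δ`. If `ℋ` lies in `𝓕_0^t` or `𝓕_1^t`, the
shifts are undone one at a time: before a shift the family still lies in a copy, on `S` or on `S`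
with `i` exchanged for `j`. For `𝓕_1^t` both copies may fail, but the two witnesses of failure then
serve as third sets in the same cross-intersection argument, and the measure is again below `p^t /
2` (`exists_subset_nearFam_one`). -/

open Classical in
/-- The `p`-biased measure, on the power set of `X`, of the sets satisfying `P`. -/
noncomputable def prob (p : ℝ) (X : Finset α) (P : Finset α → Prop) : ℝ :=
  ∑ A ∈ X.powerset, p ^ #A * (1 - p) ^ (#X - #A) * if P A then 1 else 0

variable {p : ℝ} {X : Finset α} {P Q : Finset α → Prop}

theorem prob_mono (h0 : 0 ≤ p) (h1 : p ≤ 1) (h : ∀ A ⊆ X, P A → Q A) :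
    prob p X P ≤ prob p X Q := by
  classical
  have hq : 0 ≤ 1 - p := by linarith
  refine sum_le_sum fun A hA => mul_le_mul_of_nonneg_left ?_ (by positivity)
  by_cases hP : P A
  · simp [hP, h A (mem_powerset.1 hA) hP]
  · simp only [hP, if_false]
    split_ifs <;> norm_num

theorem prob_eq_zero (h : ∀ A ⊆ X, ¬ P A) : prob p X P = 0 := by
  classical
  exact sum_eq_zero fun A hA => by simp [h A (mem_powerset.1 hA)]

variable [DecidableEq α]

theorem prob_insert {x : α} (hx : x ∉ X) :
    prob p (insert x X) P =
      (1 - p) * prob p X P + p * prob p X (fun A => P (insert x A)) := by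
  classical
  unfold prob
  rw [sum_powerset_insert hx, mul_sum, mul_sum]
  congr 1
  · refine sum_congr rfl fun A hA => ?_
    have := card_le_card (mem_powerset.1 hA)
    rw [card_insert_of_notMem hx, show #X + 1 - #A = #X - #A + 1 by omega, pow_succ]
    ring
  · refine sum_congr rfl fun A hA => ?_
    have hxA : x ∉ A := fun h => hx (mem_powerset.1 hA h)
    rw [card_insert_of_notMem hx, card_insert_of_notMem hxA, Nat.add_sub_add_right, pow_succ]
    ring

theorem prob_true : prob p X (fun _ => True) = 1 := by
  induction X using Finset.induction_on with
  | empty => simp [prob]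
  | insert x X hx ih => rw [prob_insert hx, ih]; ring

theorem prob_le_one (h0 : 0 ≤ p) (h1 : p ≤ 1) : prob p X P ≤ 1 :=
  (prob_mono h0 h1 fun _ _ _ => trivial).trans prob_true.le

theorem prob_union {U : Finset α} (h : Disjoint U X) :
    prob p (U ∪ X) P =
      ∑ R ∈ U.powerset, p ^ #R * (1 - p) ^ (#U - #R) * prob p X (fun Y => P (R ∪ Y)) := by
  induction U using Finset.induction_on generalizing P with
  | empty => simp
  | insert x U hx ih =>
    rw [disjoint_insert_left] at h
    have hx' : x ∉ U ∪ X := by simp [hx, h.1]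
    rw [insert_union, prob_insert hx', ih h.2, ih h.2, sum_powerset_insert hx, mul_sum, mul_sum]
    congr 1
    · refine sum_congr rfl fun A hA => ?_
      have := card_le_card (mem_powerset.1 hA)
      rw [card_insert_of_notMem hx, show #U + 1 - #A = #U - #A + 1 by omega, pow_succ]
      ring
    · refine sum_congr rfl fun A hA => ?_
      have hxA : x ∉ A := fun h => hx (mem_powerset.1 hA h)
      rw [card_insert_of_notMem hx, card_insert_of_notMem hxA, Nat.add_sub_add_right, pow_succ]
      simp only [insert_union]
      ring

/-- The right side is the mean of a product of `s` independent factors, each `u` with probability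
`q` and `v` otherwise. All factors are `u` with probability `q ^ s`, and the product is never below
`v ^ s`. -/
theorem pow_mul_add_le_add_pow {q u v : ℝ} (hq0 : 0 ≤ q) (hq1 : q ≤ 1) (hv : 0 ≤ v)
    (hvu : v ≤ u) (s : ℕ) :
    q ^ s * u ^ s + (1 - q ^ s) * v ^ s ≤ (q * u + (1 - q) * v) ^ s := by
  have hp : 0 ≤ 1 - q := by linarith
  have hu : 0 ≤ u := hv.trans hvu
  induction s with
  | zero => simp
  | succ s ih =>
    have hqs : q ^ s ≤ 1 := pow_le_one₀ hq0 hq1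
    have hb : 0 ≤ q * u + (1 - q) * v := by positivity
    have e1 : v * v ^ s ≤ u * v ^ s := by gcongr
    have e2 : v * v ^ s ≤ v * u ^ s := by gcongr
    have e3 : 0 ≤ q * (1 - q ^ s) := mul_nonneg hq0 (by linarith)
    have e4 : 0 ≤ (1 - q) * q ^ s := by positivity
    calc q ^ (s + 1) * u ^ (s + 1) + (1 - q ^ (s + 1)) * v ^ (s + 1)
        ≤ (q ^ s * u ^ s + (1 - q ^ s) * v ^ s) * (q * u + (1 - q) * v) := by
          rw [pow_succ, pow_succ, pow_succ]
          nlinarith [mul_le_mul_of_nonneg_left e1 e3, mul_le_mul_of_nonneg_left e2 e4]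
      _ ≤ _ := by rw [pow_succ (_ + _)]; gcongr

/-- A trade-off between the biased measures of two cross-intersecting families. -/
theorem prob_le_of_cross {s : ℕ} (h0 : 0 ≤ p) (h1 : p ≤ 1) (hs : p ≤ (1 - p) ^ s)
    (hup : ∀ A B, A ⊆ B → B ⊆ X → P A → P B)
    (hcross : ∀ A B, A ⊆ X → B ⊆ X → P A → Q B → (A ∩ B).Nonempty) :
    prob p X Q ≤ (1 - prob p X P) ^ s := by
  -- Split on a point `x`: the part of `Q` without `x` crosses the part of `P` with `x`, and
  -- conversely. The hypothesis `p ≤ (1 - p) ^ s` moves weight onto the larger power, so that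
  -- `pow_mul_add_le_add_pow` applies.
  induction X using Finset.induction_on generalizing P Q with
  | empty =>
    by_cases hP : P ∅
    · have hQ : ¬ Q ∅ := fun hQ => by simpa using hcross ∅ ∅ le_rfl le_rfl hP hQ
      simp [prob, hP, hQ]
    · by_cases hQ : Q ∅ <;> simp [prob, hP, hQ]
  | insert x X hx ih =>
    have hsub : ∀ {A}, A ⊆ X → A ⊆ insert x X := fun h => h.trans (subset_insert _ _)
    have hin : ∀ {A}, A ⊆ X → insert x A ⊆ insert x X := fun h => insert_subset_insert _ h
    have hnot : ∀ {A}, A ⊆ X → x ∉ A := fun h hA => hx (h hA)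
    set a₀ := prob p X P with ha₀
    set a₁ := prob p X (fun A => P (insert x A)) with ha₁
    have hb₀ : prob p X Q ≤ (1 - a₁) ^ s := by
      refine ih (fun A B hAB hB hA => hup _ _ (insert_subset_insert _ hAB) (hin hB) hA) ?_
      intro A B hA hB hPA hQB
      have := hcross _ _ (hin hA) (hsub hB) hPA hQB
      rwa [insert_inter_of_notMem (hnot hB)] at this
    have hb₁ : prob p X (fun B => Q (insert x B)) ≤ (1 - a₀) ^ s := by
      refine ih (fun A B hAB hB hA => hup _ _ hAB (hsub hB) hA) ?_
      intro A B hA hB hPA hQB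
      have := hcross _ _ (hsub hA) (hin hB) hPA hQB
      rwa [inter_insert_of_notMem (hnot hA)] at this
    have ha : a₀ ≤ a₁ := prob_mono h0 h1 fun A hA hP =>
      hup _ _ (subset_insert _ _) (hin hA) hP
    have ha1 : a₁ ≤ 1 := prob_le_one h0 h1
    rw [prob_insert hx, prob_insert hx, ← ha₀, ← ha₁]
    have key := pow_mul_add_le_add_pow (q := 1 - p) (u := 1 - a₀) (v := 1 - a₁)
      (by linarith) (by linarith) (by linarith) (by linarith) s
    have hpow : (1 - a₁) ^ s ≤ (1 - a₀) ^ s := by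
      have : 0 ≤ 1 - a₁ := by linarith
      gcongr
    calc _ ≤ (1 - p) * (1 - a₁) ^ s + p * (1 - a₀) ^ s := by
          have : 0 ≤ 1 - p := by linarith
          gcongr
      _ ≤ (1 - p) ^ s * (1 - a₀) ^ s + (1 - (1 - p) ^ s) * (1 - a₁) ^ s := by
          nlinarith [mul_le_mul_of_nonneg_left hpow (sub_nonneg.2 hs)]
      _ ≤ _ := key
      _ = _ := by congr 1; ring

theorem prob_min_of_cross (h0 : 0 ≤ p) (h1 : p ≤ 1 / 15)
    (hup : ∀ A B, A ⊆ B → B ⊆ X → P A → P B)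
    (hcross : ∀ A B, A ⊆ X → B ⊆ X → P A → Q B → (A ∩ B).Nonempty) :
    prob p X P ≤ 3 / 40 ∨ prob p X Q ≤ 3 / 40 := by
  by_contra! h
  -- The exponent 34 is large enough for `(37/40)^34 ≤ 3/40` and small enough for `1/15 ≤
  -- (14/15)^34`.
  have hs : p ≤ (1 - p) ^ 34 := by
    have : (14 / 15 : ℝ) ^ 34 ≤ (1 - p) ^ 34 := by
      gcongr; linarith
    have : (1 / 15 : ℝ) ≤ (14 / 15) ^ 34 := by norm_num
    linarith
  have key := prob_le_of_cross h0 (by linarith) hs hup hcross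
  have hle : prob p X P ≤ 1 := prob_le_one h0 (by linarith)
  have : (1 - prob p X P) ^ 34 ≤ (37 / 40 : ℝ) ^ 34 := by
    have : 0 ≤ 1 - prob p X P := by linarith
    gcongr; linarith [h.1]
  have : (37 / 40 : ℝ) ^ 34 ≤ 3 / 40 := by norm_num
  linarith [h.2]

end Biased

theorem mu_eq_prob {n : ℕ} (p : ℝ) (𝒢 : Finset (Finset (Fin n))) :
    mu p 𝒢 = prob p univ (· ∈ 𝒢) := by
  classical
  simp [mu, prob, mul_ite]

theorem mu_eq_sum {n : ℕ} (p : ℝ) (𝒢 : Finset (Finset (Fin n))) (U : Finset (Fin n)) :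
    mu p 𝒢 = ∑ R ∈ U.powerset,
      p ^ #R * (1 - p) ^ (#U - #R) * prob p Uᶜ (fun Y => R ∪ Y ∈ 𝒢) := by
  rw [mu_eq_prob, ← prob_union disjoint_compl_right, union_compl]

theorem mu_mono {n : ℕ} {p : ℝ} (h0 : 0 ≤ p) (h1 : p ≤ 1) {𝒢 ℋ : Finset (Finset (Fin n))}
    (h : 𝒢 ⊆ ℋ) : mu p 𝒢 ≤ mu p ℋ := by
  rw [mu_eq_prob, mu_eq_prob]
  exact prob_mono h0 h1 fun A _ hA => h hA

theorem sum_le_of_card_filter {ι : Type*} [DecidableEq ι] (s : Finset ι) (f : ι → ℝ) {c e : ℝ}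
    (hc : 0 ≤ c) (hf : ∀ a ∈ s, f a ≤ 1) (he : (#(s.filter fun a => c < f a) : ℝ) ≤ e) :
    ∑ a ∈ s, f a ≤ e + #s * c := by
  rw [← sum_filter_add_sum_filter_not s (fun a => c < f a)]
  have h1 : ∑ a ∈ s with c < f a, f a ≤ #(s.filter fun a => c < f a) * 1 := by
    rw [← nsmul_eq_mul]
    exact sum_le_card_nsmul _ _ _ fun a ha => hf a (mem_filter.1 ha).1
  have h2 : ∑ a ∈ s with ¬ c < f a, f a ≤ #(s.filter fun a => ¬ c < f a) * c := by
    rw [← nsmul_eq_mul]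
    exact sum_le_card_nsmul _ _ _ fun a ha => not_lt.1 (mem_filter.1 ha).2
  have h3 : (#(s.filter fun a => ¬ c < f a) : ℝ) * c ≤ #s * c := by
    gcongr; exact filter_subset _ _
  linarith

/-! ### Shifting and what it preserves -/

section Shifting

variable {n : ℕ}

/-- A family of subsets of `[n]` closed under taking supersets. -/
def IsUp (𝒢 : Finset (Finset (Fin n))) : Prop := ∀ A ∈ 𝒢, ∀ B, A ⊆ B → B ∈ 𝒢

theorem IsMaximal.isUp {t : ℕ} {𝒢 : Finset (Finset (Fin n))} (h : IsMaximal t 𝒢) : IsUp 𝒢 := by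
  intro A hA B hAB
  by_contra hB
  refine h.2 B hB ?_
  have key : ∀ C ∈ insert B 𝒢, ∃ C' ∈ 𝒢, C' ⊆ C := by
    intro C hC
    rcases mem_insert.1 hC with rfl | hC
    · exact ⟨A, hA, hAB⟩
    · exact ⟨C, hC, le_rfl⟩
  intro C hC D hD E hE
  obtain ⟨C', hC', h1⟩ := key C hC
  obtain ⟨D', hD', h2⟩ := key D hD
  obtain ⟨E', hE', h3⟩ := key E hE
  exact (h.1 C' hC' D' hD' E' hE').trans
    (card_le_card (inter_subset_inter (inter_subset_inter h1 h2) h3))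

theorem exists_isMaximal {t : ℕ} {𝒢 : Finset (Finset (Fin n))} (h : IsThreeWise t 𝒢) :
    ∃ 𝒢', 𝒢 ⊆ 𝒢' ∧ IsMaximal t 𝒢' := by
  obtain ⟨𝒢', hle, hmax⟩ := (Set.toFinite {𝒢 | IsThreeWise t 𝒢}).exists_le_maximal
    (a := 𝒢) h
  refine ⟨𝒢', hle, hmax.prop, fun F hF h' => hF ?_⟩
  exact hmax.le_of_ge (y := insert F 𝒢') h' (subset_insert _ _) (mem_insert_self _ _)

variable {i j : Fin n} {𝒢 : Finset (Finset (Fin n))}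

theorem inter_pair_eq_singleton (hij : i ≠ j) {A : Finset (Fin n)} :
    A ∩ {i, j} = {j} ↔ j ∈ A ∧ i ∉ A := by
  constructor
  · intro h
    have h1 := Finset.ext_iff.1 h i
    have h2 := Finset.ext_iff.1 h j
    simp [hij] at h1 h2
    exact ⟨h2, h1⟩
  · rintro ⟨h1, h2⟩
    ext x
    simp only [mem_inter, mem_insert, mem_singleton]
    constructor
    · rintro ⟨h3, rfl | rfl⟩
      · exact absurd h3 h2
      · rfl
    · rintro rfl
      exact ⟨h1, Or.inr rfl⟩

/-- The set obtained from `A` by replacing its element `j` by `i`. -/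
abbrev swapElt (i j : Fin n) (A : Finset (Fin n)) : Finset (Fin n) := (A \ {j}) ∪ {i}

theorem swapElt_swapElt (hij : i ≠ j) {A : Finset (Fin n)} (hi : i ∈ A) (hj : j ∉ A) :
    swapElt i j (swapElt j i A) = A := by
  ext x
  simp only [swapElt, mem_union, mem_sdiff, mem_singleton]
  grind

theorem card_swapElt {A : Finset (Fin n)} (hj : j ∈ A) (hi : i ∉ A) :
    #(swapElt i j A) = #A := by
  have hi' : i ∉ A \ {j} := fun h => hi (mem_sdiff.1 h).1
  rw [swapElt, card_union_of_disjoint (by simpa using fun h => absurd h hi),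
    card_sdiff_of_subset (by simpa using hj)]
  have : 0 < #A := card_pos.2 ⟨j, hj⟩
  simp only [card_singleton]
  omega

theorem shiftSet_eq (hij : i ≠ j) (A : Finset (Fin n)) :
    shiftSet 𝒢 i j A = if (j ∈ A ∧ i ∉ A) ∧ swapElt i j A ∉ 𝒢 then swapElt i j A else A := by
  simp only [shiftSet, inter_pair_eq_singleton hij]

theorem mem_shift (hij : i ≠ j) {B : Finset (Fin n)} :
    B ∈ shift i j 𝒢 ↔ (B ∈ 𝒢 ∧ (j ∈ B → i ∉ B → swapElt i j B ∈ 𝒢)) ∨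
      (i ∈ B ∧ j ∉ B ∧ swapElt j i B ∈ 𝒢) := by
  simp only [shift, mem_image]
  constructor
  · rintro ⟨A, hA, rfl⟩
    rw [shiftSet_eq hij]
    split_ifs with h
    · right
      refine ⟨by simp, by simp [hij.symm], ?_⟩
      rwa [swapElt_swapElt hij.symm h.1.1 h.1.2]
    · left
      exact ⟨hA, fun h1 h2 => by_contra fun h3 => h ⟨⟨h1, h2⟩, h3⟩⟩
  · rintro (⟨hB, h⟩ | ⟨hi, hj, hB⟩)
    · refine ⟨B, hB, ?_⟩
      rw [shiftSet_eq hij, if_neg]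
      rintro ⟨⟨h1, h2⟩, h3⟩
      exact h3 (h h1 h2)
    · by_cases hBG : B ∈ 𝒢
      · refine ⟨B, hBG, ?_⟩
        rw [shiftSet_eq hij, if_neg]
        exact fun h => hj h.1.1
      · refine ⟨_, hB, ?_⟩
        rw [shiftSet_eq hij, swapElt_swapElt hij hi hj, if_pos]
        exact ⟨⟨by simp, by simp [hij]⟩, hBG⟩

theorem shiftSet_injOn (hij : i ≠ j) : Set.InjOn (shiftSet 𝒢 i j) 𝒢 := by
  intro A hA B hB hAB
  rw [shiftSet_eq hij, shiftSet_eq hij] at hAB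
  split_ifs at hAB with h1 h2 h2
  · rw [← swapElt_swapElt hij.symm h1.1.1 h1.1.2, hAB, swapElt_swapElt hij.symm h2.1.1 h2.1.2]
  · exact absurd hB (hAB ▸ h1.2)
  · exact absurd hA (hAB ▸ h2.2)
  · exact hAB

theorem mu_shift (hij : i ≠ j) (p : ℝ) : mu p (shift i j 𝒢) = mu p 𝒢 := by
  unfold mu shift
  rw [sum_image (shiftSet_injOn hij)]
  refine sum_congr rfl fun A _ => ?_
  have : #(shiftSet 𝒢 i j A) = #A := by
    rw [shiftSet_eq hij]
    split_ifs with h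
    · exact card_swapElt h.1.1 h.1.2
    · rfl
  rw [this]

theorem IsUp.shift (hij : i ≠ j) (h : IsUp 𝒢) : IsUp (shift i j 𝒢) := by
  intro A hA B hAB
  rw [mem_shift hij] at hA ⊢
  have hsub : swapElt i j A ⊆ swapElt i j B := by
    simp only [swapElt]; gcongr
  have hsub' : swapElt j i A ⊆ swapElt j i B := by
    simp only [swapElt]; gcongr
  rcases hA with ⟨hA, h'⟩ | ⟨hi, hj, hA⟩
  · refine Or.inl ⟨h A hA B hAB, fun h1 h2 => ?_⟩
    by_cases hjA : j ∈ A
    · exact h _ (h' hjA fun h3 => h2 (hAB h3)) _ hsub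
    · refine h A hA _ fun x hx => ?_
      have : x ≠ j := fun e => hjA (e ▸ hx)
      simp [swapElt, hAB hx, this]
  · by_cases hjB : j ∈ B
    · refine Or.inl ⟨h _ hA _ ?_, fun _ h2 => absurd (hAB hi) h2⟩
      intro x hx
      simp only [swapElt, mem_union, mem_sdiff, mem_singleton] at hx
      rcases hx with hx | rfl
      · exact hAB hx.1
      · exact hjB
    · exact Or.inr ⟨hAB hi, hjB, h _ hA _ hsub'⟩

/-- Let `A` be a new set and undo its shift. If all three sets contain `i`, the common part loses
`i` and gains at most `j` on returning to `𝒢`. If one of them avoids `i`, it has a representative in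
`𝒢` avoiding `j`, and then nothing is gained. -/
theorem IsThreeWise.shift {t : ℕ} (hij : i ≠ j) (h : IsThreeWise t 𝒢) :
    IsThreeWise t (shift i j 𝒢) := by
  -- a set avoiding `i` can be replaced by a member of `𝒢` avoiding `j`
  have hrep : ∀ A ∈ ThreeWise.shift i j 𝒢, i ∉ A →
      ∃ A' ∈ 𝒢, j ∉ A' ∧ ∀ x, x ≠ i → x ∈ A' → x ∈ A := by
    intro A hA hi
    rcases (mem_shift hij).1 hA with ⟨hA, h'⟩ | ⟨hi', _⟩
    · by_cases hj : j ∈ A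
      · refine ⟨_, h' hj hi, by simp [hij.symm], ?_⟩
        intro x hx hxA
        simp only [swapElt, mem_union, mem_sdiff, mem_singleton] at hxA
        tauto
      · exact ⟨A, hA, hj, fun _ _ h => h⟩
    · exact absurd hi' hi
  have hrep' : ∀ A ∈ ThreeWise.shift i j 𝒢,
      ∃ A' ∈ 𝒢, ∀ x, x ≠ i → x ≠ j → x ∈ A' → x ∈ A := by
    intro A hA
    rcases (mem_shift hij).1 hA with ⟨hA, _⟩ | ⟨_, _, hA⟩
    · exact ⟨A, hA, fun _ _ _ h => h⟩
    · refine ⟨_, hA, fun x h1 h2 hx => ?_⟩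
      simp only [swapElt, mem_union, mem_sdiff, mem_singleton] at hx
      tauto
  have main : ∀ A ∈ ThreeWise.shift i j 𝒢, A ∉ 𝒢 → ∀ B ∈ ThreeWise.shift i j 𝒢,
      ∀ C ∈ ThreeWise.shift i j 𝒢, i ∉ B → t ≤ #(A ∩ B ∩ C) := by
    intro A hA hAG B hB C hC hi
    rcases (mem_shift hij).1 hA with ⟨hA', _⟩ | ⟨hiA, hjA, hA'⟩
    · exact absurd hA' hAG
    obtain ⟨B', hB', hjB', hsB⟩ := hrep B hB hi
    obtain ⟨C', hC', hsC⟩ := hrep' C hC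
    refine (h _ hA' _ hB' _ hC').trans (card_le_card fun x hx => ?_)
    simp only [swapElt, mem_inter, mem_union, mem_sdiff, mem_singleton] at hx ⊢
    have hxj : x ≠ j := fun e => hjB' (e ▸ hx.1.2)
    have hxi : x ≠ i := by rintro rfl; have := hx.1.1; tauto
    exact ⟨⟨(hx.1.1.resolve_right hxj).1, hsB x hxi hx.1.2⟩, hsC x hxi hxj hx.2⟩
  have main' : ∀ A ∈ ThreeWise.shift i j 𝒢, A ∉ 𝒢 → ∀ B ∈ ThreeWise.shift i j 𝒢,
      ∀ C ∈ ThreeWise.shift i j 𝒢, t ≤ #(A ∩ B ∩ C) := by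
    intro A hA hAG B hB C hC
    by_cases hiB : i ∈ B
    swap
    · exact main A hA hAG B hB C hC hiB
    by_cases hiC : i ∈ C
    swap
    · rw [inter_right_comm]
      exact main A hA hAG C hC B hB hiC
    rcases (mem_shift hij).1 hA with ⟨hA', _⟩ | ⟨hiA, hjA, hA'⟩
    · exact absurd hA' hAG
    obtain ⟨B', hB', hsB⟩ := hrep' B hB
    obtain ⟨C', hC', hsC⟩ := hrep' C hC
    have hi3 : i ∈ A ∩ B ∩ C := by simp [hiA, hiB, hiC]
    have hsub : swapElt j i A ∩ B' ∩ C' ⊆ insert j ((A ∩ B ∩ C).erase i) := by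
      intro x hx
      simp only [swapElt, mem_inter, mem_union, mem_sdiff, mem_singleton] at hx
      by_cases hxj : x = j
      · simp [hxj]
      · have hx1 := hx.1.1.resolve_right hxj
        simp [hx1.2, hx1.1, hsB x hx1.2 hxj hx.1.2, hsC x hx1.2 hxj hx.2]
    have h1 := h _ hA' _ hB' _ hC'
    have h2 := card_le_card hsub
    have h3 := card_insert_le j ((A ∩ B ∩ C).erase i)
    rw [card_erase_add_one hi3] at h3
    omega
  intro A hA B hB C hC
  by_cases hAG : A ∈ 𝒢
  swap
  · exact main' A hA hAG B hB C hC
  by_cases hBG : B ∈ 𝒢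
  swap
  · rw [inter_comm A B]
    exact main' B hB hBG A hA C hC
  by_cases hCG : C ∈ 𝒢
  swap
  · rw [inter_comm, ← inter_assoc]
    exact main' C hC hCG A hA B hB
  exact h A hAG B hBG C hCG

/-- Repeated shifting ends in a shifted family. -/
theorem exists_obtainedByShifting (𝒢 : Finset (Finset (Fin n))) :
    ∃ ℋ, ObtainedByShifting 𝒢 ℋ := by
  -- The total of all elements of all members drops strictly with every shift that moves something.
  induction hN : ∑ G ∈ 𝒢, ∑ x ∈ G, x.val using Nat.strong_induction_on generalizing 𝒢 with
  | _ N ih =>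
    by_cases hs : IsShifted 𝒢
    · exact ⟨𝒢, Relation.ReflTransGen.refl, hs⟩
    · simp only [IsShifted, not_forall] at hs
      obtain ⟨i, j, hij, hne⟩ := hs
      have hlt : ∀ A : Finset (Fin n), j ∈ A → i ∉ A →
          ∑ x ∈ swapElt i j A, x.val < ∑ x ∈ A, x.val := by
        intro A hj hi
        have hd : Disjoint (A \ {j}) {i} := by simpa using fun h => absurd h hi
        rw [swapElt, sum_union hd, sum_singleton, ← sum_sdiff (singleton_subset_iff.2 hj),
          sum_singleton]
        exact Nat.add_lt_add_left hij _
      have hmove : ∃ A ∈ 𝒢, (j ∈ A ∧ i ∉ A) ∧ swapElt i j A ∉ 𝒢 := by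
        by_contra! h
        refine hne ?_
        have : 𝒢.image (shiftSet 𝒢 i j) = 𝒢.image id := image_congr fun A hA => by
          rw [shiftSet_eq hij.ne, if_neg]
          · rfl
          · rintro ⟨h1, h2⟩
            exact h2 (h A hA h1)
        simpa [shift] using this
      have hdec : ∑ G ∈ shift i j 𝒢, ∑ x ∈ G, x.val < ∑ G ∈ 𝒢, ∑ x ∈ G, x.val := by
        rw [shift, sum_image (shiftSet_injOn hij.ne)]
        obtain ⟨A, hA, h1, h2⟩ := hmove
        refine sum_lt_sum (fun B _ => ?_) ⟨A, hA, ?_⟩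
        · rw [shiftSet_eq hij.ne]
          split_ifs with h
          · exact (hlt B h.1.1 h.1.2).le
          · rfl
        · rw [shiftSet_eq hij.ne, if_pos ⟨h1, h2⟩]
          exact hlt A h1.1 h1.2
      obtain ⟨ℋ, h1, h2⟩ := ih _ (hN ▸ hdec) (shift i j 𝒢) rfl
      exact ⟨ℋ, Relation.ReflTransGen.head ⟨i, j, hij, rfl⟩ h1, h2⟩

theorem IsShifted.swapElt_mem (h : IsShifted 𝒢) (hij : i < j) {A : Finset (Fin n)}
    (hA : A ∈ 𝒢) (hj : j ∈ A) (hi : i ∉ A) : swapElt i j A ∈ 𝒢 := by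
  rw [← h i j hij, mem_shift hij.ne] at hA
  rcases hA with ⟨_, h'⟩ | ⟨hi', _⟩
  · exact h' hj hi
  · exact absurd hi' hi

end Shifting

/-! ### Domination and walks hitting the line -/

section Walks

variable {n : ℕ}

theorem mem_seg {m : ℕ} {x : Fin n} : x ∈ seg n m ↔ x.val < m := by simp [seg]

theorem seg_succ {m : ℕ} (h : m < n) : seg n (m + 1) = insert ⟨m, h⟩ (seg n m) := by
  ext x
  simp only [mem_insert, mem_seg, Fin.ext_iff]
  omega

theorem seg_of_le {m : ℕ} (h : n ≤ m) : seg n m = univ := by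
  ext x
  simpa [mem_seg] using x.isLt.trans_le h

theorem seg_mono {a b : ℕ} (h : a ≤ b) : seg n a ⊆ seg n b := fun _ hx =>
  mem_seg.2 ((mem_seg.1 hx).trans_le h)

theorem card_seg {m : ℕ} (h : m ≤ n) : #(seg n m) = m := by
  induction m with
  | zero => simp [seg]
  | succ m ih =>
    rw [seg_succ h, card_insert_of_notMem (by simp [mem_seg]), ih (by omega)]

theorem card_seg_le (m : ℕ) : #(seg n m) ≤ m := by
  rcases le_total m n with h | h
  · exact (card_seg h).le
  · rw [seg_of_le h, card_univ, Fintype.card_fin]; exact h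

theorem card_inter_seg_le_add (F : Finset (Fin n)) {a b : ℕ} (hab : a ≤ b) :
    #(F ∩ seg n b) ≤ #(F ∩ seg n a) + (b - a) := by
  induction b, hab using Nat.le_induction with
  | base => simp
  | succ b hab ih =>
    by_cases hb : b < n
    · rw [seg_succ hb]
      have : F ∩ insert ⟨b, hb⟩ (seg n b) ⊆ insert ⟨b, hb⟩ (F ∩ seg n b) := by
        intro x hx
        simp only [mem_inter, mem_insert] at hx ⊢
        tauto
      have h1 := card_le_card this
      have h2 := card_insert_le (⟨b, hb⟩ : Fin n) (F ∩ seg n b)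
      omega
    · rw [seg_of_le (by omega : n ≤ b + 1), ← seg_of_le (by omega : n ≤ b)]
      omega

/-- A shifted up-set contains every set dominating one of its members. -/
theorem mem_of_dominated {ℋ : Finset (Finset (Fin n))} (hs : IsShifted ℋ) (hu : IsUp ℋ)
    {F D : Finset (Fin n)} (hF : F ∈ ℋ) (h : ∀ m, #(F ∩ seg n m) ≤ #(D ∩ seg n m)) : D ∈ ℋ := by
  induction hN : #(D \ F) using Nat.strong_induction_on generalizing F with
  | _ N ih =>
    by_cases hFD : (F \ D).Nonempty
    · set j := (F \ D).min' hFD with hj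
      have hjm : j ∈ F \ D := min'_mem _ _
      have hjF : j ∈ F := (mem_sdiff.1 hjm).1
      have hjD : j ∉ D := (mem_sdiff.1 hjm).2
      have hmin : ∀ x ∈ F, x < j → x ∈ D := by
        intro x hx hxj
        by_contra hxD
        exact absurd (min'_le (F \ D) x (mem_sdiff.2 ⟨hx, hxD⟩)) (not_le.2 hxj)
      -- Below `j` the set `F` lies in `D`; counting up to and including `j`, which is in `F` only,
      -- forces an extra element of `D` below it. Replacing `j` by `i` keeps the domination and
      -- shrinks `D \ F`.
      obtain ⟨i, hiD, hiF, hij⟩ : ∃ i ∈ D, i ∉ F ∧ i < j := by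
        by_contra! hcon
        have hsub : insert j (D ∩ seg n (j.val + 1)) ⊆ F ∩ seg n (j.val + 1) := by
          intro x hx
          rcases mem_insert.1 hx with rfl | hx
          · exact mem_inter.2 ⟨hjF, mem_seg.2 (Nat.lt_succ_self _)⟩
          · obtain ⟨h1, h2⟩ := mem_inter.1 hx
            refine mem_inter.2 ⟨?_, h2⟩
            by_contra hxF
            have h3 := hcon x h1 hxF
            have h4 : x ≠ j := fun e => hjD (e ▸ h1)
            have h5 := mem_seg.1 h2
            exact h4 (le_antisymm (Fin.le_def.2 (by omega)) h3)
        have h1 := card_le_card hsub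
        rw [card_insert_of_notMem (by simp [hjD])] at h1
        have := h (j.val + 1)
        omega
      have hdiff : D \ swapElt i j F = (D \ F).erase i := by
        ext x
        simp only [swapElt, mem_sdiff, mem_union, mem_singleton, mem_erase]
        grind
      have hiDF : i ∈ D \ F := mem_sdiff.2 ⟨hiD, hiF⟩
      refine ih #(D \ swapElt i j F) ?_ (hs.swapElt_mem hij hF hjF hiF) ?_ rfl
      · rw [hdiff, ← hN]
        exact card_erase_lt_of_mem hiDF
      · intro m
        by_cases hm : j.val < m
        · have : swapElt i j F ∩ seg n m = swapElt i j (F ∩ seg n m) := by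
            ext x
            have : i < j := hij
            simp only [swapElt, mem_sdiff, mem_union, mem_singleton, mem_inter, mem_seg]
            constructor
            · tauto
            · rintro (h1 | rfl)
              · tauto
              · exact ⟨Or.inr rfl, by have := Fin.lt_def.1 hij; omega⟩
          rw [this, card_swapElt (by simp [hjF, mem_seg, hm]) (by simp [hiF])]
          exact h m
        · refine card_le_card fun x hx => ?_
          simp only [swapElt, mem_sdiff, mem_union, mem_singleton, mem_inter, mem_seg] at hx ⊢
          refine ⟨?_, hx.2⟩
          rcases hx.1 with h1 | rfl
          · exact hmin x h1.1 (Fin.lt_def.2 (by omega))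
          · exact hiD
    · rw [not_nonempty_iff_eq_empty, sdiff_eq_empty_iff_subset] at hFD
      exact hu F hF D hFD

/-- The set missing every third element, starting with the `(t + r)`-th. -/
def thirdSet (n t r : ℕ) : Finset (Fin n) :=
  univ.filter fun x => x.val + 1 < t + r ∨ (x.val + 1 - (t + r)) % 3 ≠ 0

theorem card_thirdSet {t r m : ℕ} (ht : 1 ≤ t) (hm : m ≤ n) :
    #(thirdSet n t r ∩ seg n m) + (m + 3 - (t + r)) / 3 = m := by
  induction m with
  | zero =>
    have : (0 + 3 - (t + r)) / 3 = 0 := by omega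
    rw [this]
    simp [seg]
  | succ m ih =>
    have ih := ih (by omega)
    rw [seg_succ hm]
    by_cases hx : m + 1 < t + r ∨ (m + 1 - (t + r)) % 3 ≠ 0
    · rw [inter_insert_of_mem (by simpa [thirdSet] using hx),
        card_insert_of_notMem (by simp [mem_seg])]
      omega
    · rw [inter_insert_of_notMem (by simpa [thirdSet] using hx)]
      omega

/-- A walk staying below the line is dominated by `thirdSet n t r` for `r = 0, 1, 2`. Every position
from `t` on is missed by one of these three, so they share only `t - 1` points. -/
theorem exists_hit {t : ℕ} (ht : 1 ≤ t) {ℋ : Finset (Finset (Fin n))} (h3 : IsThreeWise t ℋ)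
    (hs : IsShifted ℋ) (hu : IsUp ℋ) {F : Finset (Fin n)} (hF : F ∈ ℋ) :
    ∃ i, t + 2 * i ≤ #(F ∩ seg n (t + 3 * i)) := by
  by_contra! hcon
  have hbound : ∀ m ≤ n, #(F ∩ seg n m) + (m + 3 - t) / 3 ≤ m := by
    intro m hm
    by_cases hmt : m < t
    · have h1 : #(F ∩ seg n m) ≤ m := (card_le_card inter_subset_right).trans (card_seg_le m)
      omega
    · have h1 := hcon ((m - t) / 3)
      have h2 := card_inter_seg_le_add F (a := t + 3 * ((m - t) / 3)) (b := m) (by omega)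
      omega
  have hmem : ∀ r, thirdSet n t r ∈ ℋ := by
    intro r
    refine mem_of_dominated hs hu hF fun m => ?_
    rcases le_total m n with hm | hm
    · have h1 := hbound m hm
      have h2 := card_thirdSet (n := n) (r := r) ht hm
      omega
    · have h1 := hbound n le_rfl
      have h2 := card_thirdSet (n := n) (r := r) ht (le_refl n)
      rw [seg_of_le hm, ← seg_of_le (le_refl n)]
      omega
  have h1 := h3 _ (hmem 0) _ (hmem 1) _ (hmem 2)
  have h2 : thirdSet n t 0 ∩ thirdSet n t 1 ∩ thirdSet n t 2 ⊆ seg n (t - 1) := by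
    intro x hx
    simp only [thirdSet, mem_inter, mem_filter, mem_univ, true_and] at hx
    rw [mem_seg]
    omega
  have h4 := (card_le_card h2).trans (card_seg_le _)
  omega

theorem card_seg_sdiff {m : ℕ} (hm : m ≤ n) (F : Finset (Fin n)) :
    #(seg n m \ F) + #(F ∩ seg n m) = m := by
  have := card_sdiff_add_card_inter (seg n m) F
  rw [card_seg hm, inter_comm] at this
  exact this

theorem exists_first_hit {t : ℕ} (ht : 1 ≤ t) {ℋ : Finset (Finset (Fin n))}
    (h3 : IsThreeWise t ℋ) (hs : IsShifted ℋ) (hu : IsUp ℋ) {F : Finset (Fin n)} (hF : F ∈ ℋ) :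
    ∃ i, t + 3 * i ≤ n ∧ #(seg n (t + 3 * i) \ F) = i ∧
      (i ≤ 2 → seg n (t + 3 * i) \ seg n (t + 2 * i - 1) ⊆ F) := by
  classical
  have hex := exists_hit ht h3 hs hu hF
  obtain ⟨i, hi, hmin⟩ : ∃ i, t + 2 * i ≤ #(F ∩ seg n (t + 3 * i)) ∧
      ∀ k < i, #(F ∩ seg n (t + 3 * k)) < t + 2 * k :=
    ⟨Nat.find hex, Nat.find_spec hex, fun k hk => not_le.1 (Nat.find_min hex hk)⟩
  have hFn : #(F ∩ seg n (t + 3 * i)) ≤ n := by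
    simpa using card_le_univ (F ∩ seg n (t + 3 * i))
  rcases Nat.eq_zero_or_pos i with rfl | hpos
  · have h1 := card_seg_sdiff (n := n) (m := t + 3 * 0) (by omega) F
    have h0 : #(seg n (t + 3 * 0) \ F) = 0 := by omega
    refine ⟨0, by omega, h0, fun _ => ?_⟩
    exact sdiff_subset.trans (sdiff_eq_empty_iff_subset.1 (card_eq_zero.1 h0))
  · have h0 := hmin (i - 1) (by omega)
    have hn : t + 3 * i ≤ n := by
      by_contra hn
      rw [seg_of_le (by omega : n ≤ t + 3 * i), ← seg_of_le (le_refl n)] at hi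
      rcases le_total (t + 3 * (i - 1)) n with hle | hle
      · have := card_inter_seg_le_add F hle
        omega
      · rw [seg_of_le hle, ← seg_of_le (le_refl n)] at h0
        omega
    have h1 := card_inter_seg_le_add F (a := t + 3 * (i - 1)) (b := t + 3 * i) (by omega)
    have h2 := card_seg_sdiff hn F
    have h4 := card_seg_sdiff (n := n) (m := t + 3 * (i - 1)) (by omega) F
    have hcard : #(seg n (t + 3 * i) \ F) = i := by omega
    -- Being below the line three steps earlier means that `i` elements were already missed there,
    -- so the last three all lie in `F`. The block in question has `i + 1 ≤ 3` elements.
    refine ⟨i, hn, hcard, fun hi2 x hx => ?_⟩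
    by_contra hxF
    have hsub : insert x (seg n (t + 3 * (i - 1)) \ F) ⊆ seg n (t + 3 * i) \ F := by
      intro y hy
      rcases mem_insert.1 hy with rfl | hy
      · exact mem_sdiff.2 ⟨(mem_sdiff.1 hx).1, hxF⟩
      · exact mem_sdiff.2 ⟨seg_mono (by omega) (mem_sdiff.1 hy).1, (mem_sdiff.1 hy).2⟩
    have h5 := card_le_card hsub
    rw [card_insert_of_notMem] at h5
    · omega
    · simp only [mem_sdiff, mem_seg] at hx ⊢
      omega

/-- A shifted up-set not contained in `𝓕_i^t` contains the complement of the last `i + 1`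
elements of `[t + 3i]`. -/
theorem compl_mem_of_not_subset_fam {t i : ℕ} (hn : t + 3 * i ≤ n)
    {ℋ : Finset (Finset (Fin n))} (hs : IsShifted ℋ) (hu : IsUp ℋ) (h : ¬ ℋ ⊆ fam n t i) :
    (seg n (t + 3 * i) \ seg n (t + 2 * i - 1))ᶜ ∈ ℋ := by
  obtain ⟨A, hA, hAf⟩ := not_subset.1 h
  simp only [fam, mem_filter, mem_univ, true_and, not_le] at hAf
  -- The member `A` outside the family has at most `t + 2i - 1` elements in `[t + 3i]`; moving them
  -- to the front and adding everything beyond gives a dominating set.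
  refine mem_of_dominated hs hu hA fun m => ?_
  rcases le_total m (t + 2 * i - 1) with h1 | h1
  · refine card_le_card fun x hx => ?_
    simp only [mem_inter, mem_compl, mem_sdiff, mem_seg] at hx ⊢
    omega
  · rcases le_total m (t + 3 * i) with h2 | h2
    · have h3 : seg n (t + 2 * i - 1) ⊆
          (seg n (t + 3 * i) \ seg n (t + 2 * i - 1))ᶜ ∩ seg n m := by
        intro x hx
        simp only [mem_inter, mem_compl, mem_sdiff, mem_seg] at hx ⊢
        omega
      have h4 := card_le_card h3
      rw [card_seg (by omega)] at h4
      have h5 : #(A ∩ seg n m) ≤ #(A ∩ seg n (t + 3 * i)) :=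
        card_le_card (inter_subset_inter_left (seg_mono h2))
      omega
    · have h3 : seg n (t + 2 * i - 1) ∪ (A ∩ (seg n m \ seg n (t + 3 * i))) ⊆
          (seg n (t + 3 * i) \ seg n (t + 2 * i - 1))ᶜ ∩ seg n m := by
        intro x hx
        simp only [mem_inter, mem_compl, mem_sdiff, mem_seg, mem_union] at hx ⊢
        omega
      have h4 := card_le_card h3
      rw [card_union_of_disjoint, card_seg (by omega)] at h4
      · have h5 : A ∩ seg n m ⊆
            (A ∩ seg n (t + 3 * i)) ∪ (A ∩ (seg n m \ seg n (t + 3 * i))) := by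
          intro x hx
          simp only [mem_inter, mem_sdiff, mem_union] at hx ⊢
          tauto
        have h6 := (card_le_card h5).trans (card_union_le _ _)
        omega
      · rw [disjoint_left]
        intro x hx hx'
        simp only [mem_inter, mem_sdiff, mem_seg] at hx hx'
        omega

end Walks

/-! ### Measure of the members with a given hitting time -/

section Parts

variable {n : ℕ}

theorem mu_eq_sum_missing (p : ℝ) {𝒜 : Finset (Finset (Fin n))} {U : Finset (Fin n)} {k i : ℕ}
    (hU : #U = k + i) (h : ∀ F ∈ 𝒜, #(U \ F) = i) :
    mu p 𝒜 = p ^ k * (1 - p) ^ i *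
      ∑ M ∈ U.powersetCard i, prob p Uᶜ (fun Y => (U \ M) ∪ Y ∈ 𝒜) := by
  rw [mu_eq_sum p 𝒜 U, mul_sum]
  have hcard : ∀ M ∈ U.powersetCard i, #(U \ M) = k := by
    intro M hM
    obtain ⟨h1, h2⟩ := mem_powersetCard.1 hM
    rw [card_sdiff_of_subset h1, hU, h2, Nat.add_sub_cancel]
  symm
  refine sum_of_injOn (fun M => U \ M) ?_ ?_ ?_ ?_
  · intro M hM M' hM' hMM
    have h1 := (mem_powersetCard.1 hM).1
    have h2 := (mem_powersetCard.1 hM').1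
    rw [← Finset.sdiff_sdiff_eq_self h1, ← Finset.sdiff_sdiff_eq_self h2]
    exact congrArg (U \ ·) hMM
  · intro M _
    simp
  · intro R hR hR'
    rw [prob_eq_zero, mul_zero]
    intro Y hY hmem
    have hRU := mem_powerset.1 hR
    have hdiff : U \ (R ∪ Y) = U \ R := by
      ext x
      simp only [mem_sdiff, mem_union]
      have : x ∈ Y → x ∉ U := fun hx => mem_compl.1 (hY hx)
      tauto
    refine hR' ⟨U \ R, ?_, Finset.sdiff_sdiff_eq_self hRU⟩
    have := h _ hmem
    rw [hdiff] at this
    exact mem_coe.2 (mem_powersetCard.2 ⟨sdiff_subset, this⟩)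
  · intro M hM
    simp only [hcard M hM]
    rw [hU, Nat.add_sub_cancel_left]

theorem mu_le_choose {p : ℝ} (h0 : 0 ≤ p) (h1 : p ≤ 1) {𝒜 : Finset (Finset (Fin n))}
    {U : Finset (Fin n)} {k i : ℕ} (hU : #U = k + i) (h : ∀ F ∈ 𝒜, #(U \ F) = i) :
    mu p 𝒜 ≤ p ^ k * (1 - p) ^ i * (k + i).choose i := by
  have hq : 0 ≤ 1 - p := by linarith
  rw [mu_eq_sum_missing p hU h]
  gcongr
  have := sum_le_card_nsmul (U.powersetCard i)
    (fun M => prob p Uᶜ (fun Y => (U \ M) ∪ Y ∈ 𝒜)) 1 fun M _ => prob_le_one h0 h1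
  simpa [hU] using this

/-- The members of `ℋ` whose walk first meets the line `y = 2x + t` after `t + 3i` steps. -/
def hitPart (ℋ : Finset (Finset (Fin n))) (t i : ℕ) : Finset (Finset (Fin n)) :=
  ℋ.filter fun F => #(seg n (t + 3 * i) \ F) = i ∧
    (i ≤ 2 → seg n (t + 3 * i) \ seg n (t + 2 * i - 1) ⊆ F)

theorem prob_link_hitPart {p : ℝ} (h0 : 0 ≤ p) (h1 : p ≤ 1 / 15) {t i : ℕ} (ht : 1 ≤ t)
    (hi : i ≤ 2) (hn : t + 3 * i ≤ n) {ℋ : Finset (Finset (Fin n))} (h3 : IsThreeWise t ℋ)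
    (hs : IsShifted ℋ) (hu : IsUp ℋ) (hsub : ¬ ℋ ⊆ fam n t i) {M M' : Finset (Fin n)}
    (hM : M ∈ (seg n (t + 3 * i)).powersetCard i) (hM' : M' ∈ (seg n (t + 3 * i)).powersetCard i)
    (hd : Disjoint M M') :
    prob p (seg n (t + 3 * i))ᶜ (fun Y => (seg n (t + 3 * i) \ M) ∪ Y ∈ hitPart ℋ t i) ≤ 3 / 40 ∨
    prob p (seg n (t + 3 * i))ᶜ
      (fun Y => (seg n (t + 3 * i) \ M') ∪ Y ∈ hitPart ℋ t i) ≤ 3 / 40 := by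
  have hD := compl_mem_of_not_subset_fam hn hs hu hsub
  obtain ⟨U, hU⟩ : ∃ U, U = seg n (t + 3 * i) := ⟨_, rfl⟩
  obtain ⟨T, hT⟩ : ∃ T, T = U \ seg n (t + 2 * i - 1) := ⟨_, rfl⟩
  rw [← hU, ← hT] at hD
  rw [← hU] at hM hM' ⊢
  have hTU : T ⊆ U := hT ▸ sdiff_subset
  have hUcard : #U = t + 3 * i := hU ▸ card_seg hn
  have hTcard : #T = i + 1 := by
    rw [hT, card_sdiff_of_subset (hU ▸ seg_mono (by omega)), hUcard, card_seg (by omega)]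
    omega
  rw [mem_powersetCard] at hM hM'
  have hdisj : ∀ {N Y : Finset (Fin n)}, N ⊆ U → Y ⊆ Uᶜ → (U \ N) ∪ Y ∈ hitPart ℋ t i →
      Disjoint N T := by
    intro N Y hN hY hmem
    rw [disjoint_left]
    intro x hxN hxT
    have := (mem_filter.1 hmem).2.2 hi (hU ▸ hT ▸ hxT)
    simp only [mem_union, mem_sdiff] at this
    rcases this with h | h
    · exact h.2 hxN
    · exact (mem_compl.1 (hY h)) (hN hxN)
  refine prob_min_of_cross h0 h1 ?_ ?_
  · intro A B hAB hB hA
    obtain ⟨h4, h5, h6⟩ := mem_filter.1 hA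
    have hAB' : U \ M ∪ A ⊆ U \ M ∪ B := union_subset_union_right hAB
    refine mem_filter.2 ⟨hu _ h4 _ hAB', ?_, fun h => (h6 h).trans hAB'⟩
    refine (congrArg card ?_).trans h5
    rw [← hU]
    ext x
    simp only [mem_sdiff, mem_union]
    have e1 : x ∈ A → x ∉ U := fun hx => mem_compl.1 (hB (hAB hx))
    have e2 : x ∈ B → x ∉ U := fun hx => mem_compl.1 (hB hx)
    tauto
  · intro A B hA hB hPA hQB
    have hMT := hdisj hM.1 hA hPA
    have hMT' := hdisj hM'.1 hB hQB
    by_contra hemp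
    rw [not_nonempty_iff_eq_empty] at hemp
    have h4 := h3 _ (mem_filter.1 hPA).1 _ (mem_filter.1 hQB).1 _ hD
    have h5 : (U \ M ∪ A) ∩ (U \ M' ∪ B) ∩ Tᶜ ⊆ U \ (M ∪ M' ∪ T) := by
      intro x hx
      simp only [mem_inter, mem_union, mem_sdiff, mem_compl] at hx ⊢
      have e1 : x ∈ A → x ∉ U := fun hx => mem_compl.1 (hA hx)
      have e2 : x ∈ B → x ∉ U := fun hx => mem_compl.1 (hB hx)
      obtain ⟨⟨h7 | h7, h8 | h8⟩, h9⟩ := hx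
      · exact ⟨h7.1, fun h => h.elim (fun h => h.elim h7.2 h8.2) h9⟩
      · exact absurd h7.1 (e2 h8)
      · exact absurd h8.1 (e1 h7)
      · have := mem_inter.2 ⟨h7, h8⟩
        simp [hemp] at this
    have h6 := card_le_card h5
    -- `M`, `M'` and `T` are pairwise disjoint, so `t + 3i - 2i - (i + 1) = t - 1` points remain.
    rw [card_sdiff_of_subset (union_subset (union_subset hM.1 hM'.1) hTU),
      card_union_of_disjoint (disjoint_union_left.2 ⟨hMT, hMT'⟩), card_union_of_disjoint hd,
      hM.2, hM'.2, hTcard, hUcard] at h6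
    omega

/-- Every pair passes through one of the two points of a fixed member. The bound is crude, but it is
only used with a factor `v ^ 2`. -/
theorem card_intersecting_pairs_le {α : Type*} [DecidableEq α] {U : Finset α}
    {𝒮 : Finset (Finset α)} (hS : 𝒮 ⊆ U.powersetCard 2)
    (h : ∀ M ∈ 𝒮, ∀ M' ∈ 𝒮, ¬ Disjoint M M') : #𝒮 ≤ 2 * #U := by
  rcases 𝒮.eq_empty_or_nonempty with rfl | ⟨M₀, hM₀⟩
  · simp
  obtain ⟨x, y, _, rfl⟩ := card_eq_two.1 (mem_powersetCard.1 (hS hM₀)).2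
  have hsub : 𝒮 ⊆ U.image (fun z => {x, z}) ∪ U.image (fun z => {y, z}) := by
    intro M hM
    obtain ⟨hMU, hM2⟩ := mem_powersetCard.1 (hS hM)
    obtain ⟨a, b, _, rfl⟩ := card_eq_two.1 hM2
    have ha : a ∈ U := hMU (by simp)
    have hb : b ∈ U := hMU (by simp)
    obtain ⟨z, hz1, hz2⟩ := not_disjoint_iff.1 (h _ hM₀ _ hM)
    simp only [mem_insert, mem_singleton] at hz1 hz2
    simp only [mem_union, mem_image]
    rcases hz1 with rfl | rfl <;> rcases hz2 with rfl | rfl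
    · exact Or.inl ⟨b, hb, rfl⟩
    · exact Or.inl ⟨a, ha, pair_comm _ _⟩
    · exact Or.inr ⟨b, hb, rfl⟩
    · exact Or.inr ⟨a, ha, pair_comm _ _⟩
  calc #𝒮 ≤ _ := card_le_card hsub
    _ ≤ _ := card_union_le _ _
    _ ≤ #U + #U := add_le_add card_image_le card_image_le
    _ = _ := by ring

/-- A bound for the size of an intersecting family of `i`-subsets of an `m`-set, `i ≤ 2`. -/
def interBound (m : ℕ) : ℕ → ℕ
  | 0 => 0
  | 1 => 1
  | _ => 2 * m

theorem card_le_interBound {α : Type*} [DecidableEq α] {U : Finset α}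
    {𝒮 : Finset (Finset α)} {i : ℕ} (hi : i ≤ 2) (hS : 𝒮 ⊆ U.powersetCard i)
    (h : ∀ M ∈ 𝒮, ∀ M' ∈ 𝒮, ¬ Disjoint M M') : #𝒮 ≤ interBound #U i := by
  interval_cases i
  · have : 𝒮 = ∅ := by
      refine eq_empty_of_forall_notMem fun M hM => h M hM M hM ?_
      rw [card_eq_zero.1 (mem_powersetCard.1 (hS hM)).2]
      exact disjoint_empty_left _
    simp [this]
  · refine card_le_one.2 fun M hM M' hM' => ?_
    obtain ⟨a, rfl⟩ := card_eq_one.1 (mem_powersetCard.1 (hS hM)).2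
    obtain ⟨b, rfl⟩ := card_eq_one.1 (mem_powersetCard.1 (hS hM')).2
    have := h _ hM _ hM'
    simp only [disjoint_singleton, not_not] at this
    rw [this]
  · exact card_intersecting_pairs_le hS h

/-- By `prob_link_hitPart`, the missing sets with link heavier than `3/40` pairwise intersect. They
are counted with weight 1, all others with `3/40`. -/
theorem mu_hitPart_le {p : ℝ} (h0 : 0 ≤ p) (h1 : p ≤ 1 / 15) {t i : ℕ} (ht : 1 ≤ t)
    (hi : i ≤ 2) (hn : t + 3 * i ≤ n) {ℋ : Finset (Finset (Fin n))} (h3 : IsThreeWise t ℋ)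
    (hs : IsShifted ℋ) (hu : IsUp ℋ) (hsub : ¬ ℋ ⊆ fam n t i) :
    mu p (hitPart ℋ t i) ≤ p ^ (t + 2 * i) * (1 - p) ^ i *
      (interBound (t + 3 * i) i + (t + 3 * i).choose i * (3 / 40)) := by
  have hq : 0 ≤ 1 - p := by linarith
  have hU : #(seg n (t + 3 * i)) = t + 2 * i + i := by rw [card_seg hn]; ring
  rw [mu_eq_sum_missing p hU fun F hF => (mem_filter.1 hF).2.1]
  gcongr
  have key := sum_le_of_card_filter ((seg n (t + 3 * i)).powersetCard i)
    (fun M => prob p (seg n (t + 3 * i))ᶜ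
      (fun Y => (seg n (t + 3 * i) \ M) ∪ Y ∈ hitPart ℋ t i))
    (c := 3 / 40) (e := interBound (t + 3 * i) i) (by norm_num)
    (fun M _ => prob_le_one h0 (by linarith)) ?_
  · rwa [card_powersetCard, card_seg hn] at key
  · rw [Nat.cast_le]
    have := card_le_interBound hi (filter_subset (fun M => (3 / 40 : ℝ) <
      prob p (seg n (t + 3 * i))ᶜ (fun Y => (seg n (t + 3 * i) \ M) ∪ Y ∈ hitPart ℋ t i))
      ((seg n (t + 3 * i)).powersetCard i)) ?_
    · rwa [card_seg hn] at this
    · intro M hM M' hM' hd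
      rw [mem_filter] at hM hM'
      rcases prob_link_hitPart h0 h1 ht hi hn h3 hs hu hsub hM.1 hM'.1 hd with h | h
      · exact absurd hM.2 (not_lt.2 h)
      · exact absurd hM'.2 (not_lt.2 h)

theorem mu_le_sum_of_cover {p : ℝ} (h0 : 0 ≤ p) (h1 : p ≤ 1) {ι : Type*} (s : Finset ι)
    {𝒢 : Finset (Finset (Fin n))} (𝒜 : ι → Finset (Finset (Fin n)))
    (h : ∀ G ∈ 𝒢, ∃ i ∈ s, G ∈ 𝒜 i) : mu p 𝒢 ≤ ∑ i ∈ s, mu p (𝒜 i) := by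
  classical
  have hq : 0 ≤ 1 - p := by linarith
  set w : Finset (Fin n) → ℝ := fun G => p ^ #G * (1 - p) ^ (n - #G) with hw
  have hw0 : ∀ G, 0 ≤ w G := fun G => by positivity
  have e : ∀ i, mu p (𝒜 i) = ∑ G : Finset (Fin n), if G ∈ 𝒜 i then w G else 0 := by
    intro i
    simp [mu, hw]
  simp only [e]
  rw [sum_comm]
  calc mu p 𝒢 ≤ ∑ G ∈ 𝒢, ∑ i ∈ s, (if G ∈ 𝒜 i then w G else 0) := by
        refine sum_le_sum fun G hG => ?_
        obtain ⟨i, hi, hGi⟩ := h G hG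
        calc w G = if G ∈ 𝒜 i then w G else 0 := by rw [if_pos hGi]
          _ ≤ _ := single_le_sum (f := fun i => if G ∈ 𝒜 i then w G else 0)
            (fun k _ => by split_ifs <;> simp [hw0]) hi
    _ ≤ _ := sum_le_sum_of_subset_of_nonneg (subset_univ _) fun G _ _ =>
        sum_nonneg fun k _ => by split_ifs <;> simp [hw0]

theorem sum_range_le_of_halving {f : ℕ → ℝ} (h0 : ∀ i, 0 ≤ f i)
    (h : ∀ i, 4 ≤ i → 2 * f (i + 1) ≤ f i) (N : ℕ) :
    ∑ i ∈ range N, f i ≤ f 0 + f 1 + f 2 + f 3 + 2 * f 4 := by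
  -- Counting the last term twice makes the induction close: halving pays for two copies of the next
  -- one.
  have key : ∀ N, ∑ i ∈ range (N + 5), f i + f (N + 4) ≤ f 0 + f 1 + f 2 + f 3 + 2 * f 4 := by
    intro N
    induction N with
    | zero => simp [sum_range_succ]; linarith
    | succ N ih =>
      rw [show N + 1 + 5 = N + 5 + 1 by ring, sum_range_succ, show N + 1 + 4 = N + 4 + 1 by ring]
      have := h (N + 4) (by omega)
      rw [show N + 5 = N + 4 + 1 by ring] at ih ⊢
      linarith
  calc ∑ i ∈ range N, f i ≤ ∑ i ∈ range (N + 5), f i :=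
        sum_le_sum_of_subset_of_nonneg (range_mono (by omega)) fun i _ _ => h0 i
    _ ≤ _ := by linarith [key N, h0 (N + 4)]

/-- Two of the three factors in the ratio of binomials are at most `3/2`, which leaves `9/2 * (1 +
i/81) ≤ i + 1`. This holds from `i = 4` on and fails at `i = 3`. -/
theorem choose_halving {t i : ℕ} (ht : 241 ≤ t) (hi : 4 ≤ i) {v : ℝ} (hv0 : 0 ≤ v)
    (hv : (t + 2) * v ≤ 1) :
    2 * ((t + 3 * (i + 1)).choose (i + 1) * v ^ (i + 1)) ≤ (t + 3 * i).choose i * v ^ i := by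
  obtain ⟨N, hN⟩ : ∃ N, N = t + 3 * i := ⟨_, rfl⟩
  have hNi : N - i = t + 2 * i := by omega
  have e1 : (N + 3).choose (i + 1) * (i + 1) = (N + 3) * (N + 2).choose i := by
    rw [← Nat.add_one_mul_choose_eq]
  have e2 : (N + 2).choose i * (N + 2 - i) = (N + 2) * (N + 1).choose i := by
    have := Nat.choose_mul_succ_eq (N + 1) i
    rw [mul_comm (N + 2)]
    simpa using this.symm
  have e3 : (N + 1).choose i * (N + 1 - i) = (N + 1) * N.choose i := by
    have := Nat.choose_mul_succ_eq N i
    rw [mul_comm (N + 1)]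
    simpa using this.symm
  rw [show N + 2 - i = t + 2 * i + 2 by omega] at e2
  rw [show N + 1 - i = t + 2 * i + 1 by omega] at e3
  have e1' : ((N + 3).choose (i + 1) : ℝ) * (i + 1) = (N + 3) * (N + 2).choose i := by
    exact_mod_cast e1
  have e2' : ((N + 2).choose i : ℝ) * (t + 2 * i + 2) = (N + 2) * (N + 1).choose i := by
    exact_mod_cast e2
  have e3' : ((N + 1).choose i : ℝ) * (t + 2 * i + 1) = (N + 1) * N.choose i := by
    exact_mod_cast e3
  have hNr : (N : ℝ) = t + 3 * i := by exact_mod_cast hN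
  have htr : (241 : ℝ) ≤ t := by exact_mod_cast ht
  have hir : (4 : ℝ) ≤ i := by exact_mod_cast hi
  rw [show t + 3 * (i + 1) = N + 3 by omega, ← hN]
  set A : ℝ := ((N.choose i : ℕ) : ℝ)
  set B : ℝ := (((N + 1).choose i : ℕ) : ℝ)
  set C : ℝ := (((N + 2).choose i : ℕ) : ℝ)
  set D : ℝ := (((N + 3).choose (i + 1) : ℕ) : ℝ)
  have hA : 0 ≤ A := Nat.cast_nonneg _
  have hB : 0 ≤ B := Nat.cast_nonneg _
  have hC : 0 ≤ C := Nat.cast_nonneg _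
  have hBle : B * (t + 2 * i + 1) = (t + 3 * i + 1) * A := by rw [e3', hNr]
  have hCle : C ≤ 3 / 2 * B := by
    have : C * (t + 2 * i + 2) ≤ 3 / 2 * B * (t + 2 * i + 2) := by
      rw [e2', hNr]; nlinarith
    exact le_of_mul_le_mul_right this (by positivity)
  have hDle : D * (i + 1) ≤ 9 / 4 * (t + 3 * i + 1) * A := by
    rw [e1', hNr]
    have h1 : (t + 3 * i + 3 : ℝ) ≤ 3 / 2 * (t + 2 * i + 1) := by linarith
    calc (t + 3 * i + 3) * C ≤ (3 / 2 * (t + 2 * i + 1)) * (3 / 2 * B) := by gcongr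
      _ = 9 / 4 * (B * (t + 2 * i + 1)) := by ring
      _ = _ := by rw [hBle]; ring
  have hvt : (t + 3 * i + 1) * v ≤ 1 + i / 81 := by
    have : v ≤ 1 / 243 := by rw [le_div_iff₀ (by norm_num)]; nlinarith
    nlinarith
  have hfin : 2 * D * v ≤ A := by
    have : (2 * D * v) * (i + 1) ≤ A * (i + 1) := by
      calc (2 * D * v) * (i + 1) = 2 * v * (D * (i + 1)) := by ring
        _ ≤ 2 * v * (9 / 4 * (t + 3 * i + 1) * A) := by gcongr
        _ = 9 / 2 * ((t + 3 * i + 1) * v) * A := by ring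
        _ ≤ 9 / 2 * (1 + i / 81) * A := by gcongr
        _ ≤ A * (i + 1) := by nlinarith
    exact le_of_mul_le_mul_right this (by positivity)
  calc 2 * (D * v ^ (i + 1)) = (2 * D * v) * v ^ i := by ring
    _ ≤ A * v ^ i := by gcongr

theorem choose_mul_pow_le {t k i : ℕ} {v r : ℝ} (hv0 : 0 ≤ v) (hr : (t + k) * v ≤ r) :
    (t + k).choose i * v ^ i ≤ r ^ i / i.factorial := by
  have h := Nat.choose_le_pow_div (α := ℝ) i (t + k)
  calc ((t + k).choose i : ℝ) * v ^ i ≤ ((t + k : ℕ) : ℝ) ^ i / i.factorial * v ^ i := by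
        gcongr
    _ = (((t + k : ℕ) : ℝ) * v) ^ i / i.factorial := by rw [mul_pow]; ring
    _ ≤ _ := by
      have : 0 ≤ ((t + k : ℕ) : ℝ) * v := by positivity
      gcongr
      simpa using hr

end Parts

/-! ### Numerical estimates -/

section Measure

variable {n : ℕ}

/-- `p₀ t` is the positive root of `(t + 2) x² = 1 + x`. The proof completes the square: `p √(4t+9)
≤ 2 + p`. -/
theorem mul_sq_le_of_le_p₀ {t : ℕ} (ht : 241 ≤ t) {p : ℝ} (hp : 0 < p) (h : p ≤ p₀ t) :
    (t + 2) * p ^ 2 ≤ 1 + p := by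
  have htr : (241 : ℝ) ≤ t := by exact_mod_cast ht
  set s := Real.sqrt (4 * t + 9) with hs
  have hsq : s ^ 2 = 4 * t + 9 := Real.sq_sqrt (by positivity)
  have hs1 : 1 < s := by
    rw [hs, Real.lt_sqrt (by norm_num)]; linarith
  have h1 : p * (s - 1) ≤ 2 := by
    rw [p₀, ← hs, le_div_iff₀ (by linarith)] at h
    exact h
  have h2 : p * s ≤ 2 + p := by linarith
  have h3 : (p * s) ^ 2 ≤ (2 + p) ^ 2 := by gcongr
  rw [mul_pow, hsq] at h3
  linarith

theorem le_one_div_of_mul_sq_le {t : ℕ} (ht : 241 ≤ t) {p : ℝ} (hp : 0 < p)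
    (h : (t + 2) * p ^ 2 ≤ 1 + p) : p ≤ 1 / 15 := by
  have htr : (241 : ℝ) ≤ t := by exact_mod_cast ht
  by_contra! hc
  nlinarith [mul_pos hp hp]

theorem mul_sq_mul_le_one {t : ℕ} {p : ℝ} (h1 : p ≤ 1)
    (h : (t + 2) * p ^ 2 ≤ 1 + p) : (t + 2) * (p ^ 2 * (1 - p)) ≤ 1 := by
  nlinarith [mul_le_mul_of_nonneg_right h (sub_nonneg.2 h1), sq_nonneg p]

/-- The measure of a shifted family contained in none of `𝓕_0^t`, `𝓕_1^t`, `𝓕_2^t`. -/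
theorem mu_lt_of_shifted {t : ℕ} (ht : 241 ≤ t) {p : ℝ} (hp : 0 < p)
    (hpt : (t + 2) * p ^ 2 ≤ 1 + p) {ℋ : Finset (Finset (Fin n))} (h3 : IsThreeWise t ℋ)
    (hs : IsShifted ℋ) (hu : IsUp ℋ) (hsub : ∀ i ≤ 2, t + 3 * i ≤ n → ¬ ℋ ⊆ fam n t i) :
    mu p ℋ < 1 / 2 * p ^ t := by
  have h15 := le_one_div_of_mul_sq_le ht hp hpt
  have hq : 0 ≤ 1 - p := by linarith
  have htr : (241 : ℝ) ≤ t := by exact_mod_cast ht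
  obtain ⟨v, hv⟩ : ∃ v, v = p ^ 2 * (1 - p) := ⟨_, rfl⟩
  have hv0 : 0 ≤ v := by rw [hv]; positivity
  have hv1 : (t + 2) * v ≤ 1 := hv ▸ mul_sq_mul_le_one (by linarith) hpt
  have hv2 : v ≤ 1 / 225 := by
    rw [hv]; nlinarith
  have hpow : ∀ i, p ^ (t + 2 * i) * (1 - p) ^ i = p ^ t * v ^ i := by
    intro i
    rw [hv, mul_pow, pow_add, pow_mul]
    ring
  let f : ℕ → ℝ := fun i => if i ≤ 2 then
    v ^ i * (interBound (t + 3 * i) i + (t + 3 * i).choose i * (3 / 40))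
    else (t + 3 * i).choose i * v ^ i
  have hf0 : ∀ i, 0 ≤ f i := by
    intro i
    simp only [f]
    split_ifs <;> positivity
  have hpart : ∀ i, mu p (if t + 3 * i ≤ n then hitPart ℋ t i else ∅) ≤ p ^ t * f i := by
    intro i
    split_ifs with hn
    swap
    · have := mul_nonneg (pow_nonneg hp.le t) (hf0 i)
      simpa [mu] using this
    by_cases hi : i ≤ 2
    · have := mu_hitPart_le hp.le h15 (by omega) hi hn h3 hs hu (hsub i hi hn)
      rw [hpow] at this
      simp only [f, if_pos hi]
      linarith
    · have := mu_le_choose hp.le (by linarith) (𝒜 := hitPart ℋ t i) (U := seg n (t + 3 * i))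
        (k := t + 2 * i) (i := i) (by rw [card_seg hn]; ring) fun F hF => (mem_filter.1 hF).2.1
      rw [hpow, show t + 2 * i + i = t + 3 * i by ring] at this
      simp only [f, if_neg hi]
      linarith
  have hcover : mu p ℋ ≤ ∑ i ∈ range (n + 1),
      mu p (if t + 3 * i ≤ n then hitPart ℋ t i else ∅) := by
    refine mu_le_sum_of_cover hp.le (by linarith) _ _ fun F hF => ?_
    obtain ⟨i, hn, h4, h5⟩ := exists_first_hit (by omega) h3 hs hu hF
    refine ⟨i, mem_range.2 (by omega), ?_⟩
    rw [if_pos hn]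
    exact mem_filter.2 ⟨hF, h4, h5⟩
  have hsum := sum_range_le_of_halving hf0 (fun i hi => by
    simp only [f, if_neg (by omega : ¬ i + 1 ≤ 2), if_neg (by omega : ¬ i ≤ 2)]
    exact choose_halving ht hi hv0 hv1) (n + 1)
  have hk : ∀ k : ℕ, (2 : ℝ) ≤ k → (t + k) * v ≤ 1 + (k - 2) / 243 := by
    intro k hk
    have : v ≤ 1 / 243 := by rw [le_div_iff₀ (by norm_num)]; nlinarith
    nlinarith
  have b1 := choose_mul_pow_le (k := 3) (i := 1) hv0 (hk 3 (by norm_num))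
  have b2 := choose_mul_pow_le (k := 6) (i := 2) hv0 (hk 6 (by norm_num))
  have b3 := choose_mul_pow_le (k := 9) (i := 3) hv0 (hk 9 (by norm_num))
  have b4 := choose_mul_pow_le (k := 12) (i := 4) hv0 (hk 12 (by norm_num))
  have b5 : (t + 6) * v * v ≤ 247 / 243 * (1 / 225) := by
    have := hk 6 (by norm_num)
    push_cast at this
    exact mul_le_mul (by linarith) hv2 hv0 (by norm_num)
  -- The leading terms are `3/40 + 3/40 + 3/80 + 1/6 + 2/24 = 7/16`. The slack absorbs the heavy
  -- links, `v + 2(t+6)v²`, and the replacement of `t + 2` by `t + k`.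
  have hlt : f 0 + f 1 + f 2 + f 3 + 2 * f 4 < 1 / 2 := by
    have e0 : f 0 = 3 / 40 := by simp [f, interBound]
    have e1 : f 1 = v + (t + 3).choose 1 * v ^ 1 * (3 / 40) := by
      simp [f, interBound]; ring
    have e2 : f 2 = 2 * ((t + 6) * v * v) + (t + 6).choose 2 * v ^ 2 * (3 / 40) := by
      simp [f, interBound]; ring
    have e3 : f 3 = (t + 9).choose 3 * v ^ 3 := by simp [f]
    have e4 : f 4 = (t + 12).choose 4 * v ^ 4 := by simp [f]
    rw [e0, e1, e2, e3, e4]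
    norm_num [Nat.factorial] at b1 b2 b3 b4 ⊢
    norm_num at b5
    linarith
  have hpt0 : 0 < p ^ t := by positivity
  calc mu p ℋ ≤ _ := hcover
    _ ≤ ∑ i ∈ range (n + 1), p ^ t * f i := sum_le_sum fun i _ => hpart i
    _ = p ^ t * ∑ i ∈ range (n + 1), f i := by rw [mul_sum]
    _ < p ^ t * (1 / 2) := by
      gcongr
      exact hsum.trans_lt hlt
    _ = _ := by ring

/-- The bound on families that shift into `𝓕_2^t`. -/
theorem mu_lt_of_subset_fam_two {t : ℕ} (ht : 241 ≤ t) (hn : t + 3 * 2 ≤ n) {p : ℝ} (hp : 0 < p)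
    (hpt : (t + 2) * p ^ 2 ≤ 1 + p) {ℋ : Finset (Finset (Fin n))} (h : ℋ ⊆ fam n t 2) {δ : ℝ}
    (hδ : 0 < δ) (hδt : 18 / δ ^ 2 + 12 / δ < t) : mu p ℋ < (1 / 2 + δ) * p ^ t := by
  have h15 := le_one_div_of_mul_sq_le ht hp hpt
  have hq : 0 ≤ 1 - p := by linarith
  have htr : (241 : ℝ) ≤ t := by exact_mod_cast ht
  have hU : #(seg n (t + 3 * 2)) = t + 6 := card_seg hn
  -- Union bound over pairs: the missed elements, at most two, are padded to exactly two.
  have hcover : mu p ℋ ≤ ∑ M ∈ (seg n (t + 3 * 2)).powersetCard 2,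
      mu p (univ.filter fun F => seg n (t + 3 * 2) \ M ⊆ F) := by
    refine mu_le_sum_of_cover hp.le (by linarith) _ _ fun F hF => ?_
    have hF := (mem_filter.1 (h hF)).2
    have h1 := card_seg_sdiff hn F
    obtain ⟨M, hM1, hM2, hM3⟩ := exists_subsuperset_card_eq (n := 2)
      (sdiff_subset : seg n (t + 3 * 2) \ F ⊆ seg n (t + 3 * 2)) (by omega) (by omega)
    refine ⟨M, mem_powersetCard.2 ⟨hM2, hM3⟩, mem_filter.2 ⟨mem_univ _, fun x hx => ?_⟩⟩
    by_contra hxF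
    exact (mem_sdiff.1 hx).2 (hM1 (mem_sdiff.2 ⟨(mem_sdiff.1 hx).1, hxF⟩))
  have hcyl : ∀ M ∈ (seg n (t + 3 * 2)).powersetCard 2,
      mu p (univ.filter fun F => seg n (t + 3 * 2) \ M ⊆ F) ≤ p ^ (t + 4) := by
    intro M hM
    obtain ⟨hM1, hM2⟩ := mem_powersetCard.1 hM
    have := mu_le_choose hp.le (by linarith) (i := 0) (k := t + 4)
      (𝒜 := univ.filter fun F => seg n (t + 3 * 2) \ M ⊆ F) (U := seg n (t + 3 * 2) \ M)
      (by rw [card_sdiff_of_subset hM1, hU, hM2]; rfl)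
      (fun F hF => by rw [sdiff_eq_empty_iff_subset.2 (mem_filter.1 hF).2, card_empty])
    simpa using this
  have hsum := hcover.trans (sum_le_card_nsmul _ _ _ hcyl)
  rw [card_powersetCard, hU, nsmul_eq_mul] at hsum
  have hpt0 : 0 < p ^ t := by positivity
  have hchoose : ((t + 6).choose 2 : ℝ) ≤ (t + 6) ^ 2 / 2 := by
    have := Nat.choose_le_pow_div (α := ℝ) 2 (t + 6)
    simpa [Nat.factorial] using this
  have hpδ : p ≤ δ / 3 := by
    by_contra! hc
    have h1 : 18 / δ ^ 2 < t := lt_of_le_of_lt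
      (by linarith [div_pos (by norm_num : (0:ℝ) < 12) hδ]) hδt
    rw [div_lt_iff₀ (by positivity)] at h1
    nlinarith
  -- `1 + b = (t + 6) / (t + 2)`. With `p` and `b` both at most `δ / 3`, the error `3(b + p)` is at
  -- most `2δ`.
  obtain ⟨b, hb⟩ : ∃ b : ℝ, b = 4 / (t + 2) := ⟨_, rfl⟩
  have hb0 : 0 < b := by rw [hb]; positivity
  have hbt : b * (t + 2) = 4 := by rw [hb]; field_simp
  have hbδ : b ≤ δ / 3 := by
    have h1 : 12 / δ < t := lt_of_le_of_lt
      (by linarith [div_pos (by norm_num : (0:ℝ) < 18) (pow_pos hδ 2)]) hδt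
    rw [div_lt_iff₀ hδ] at h1
    rw [hb, div_le_div_iff₀ (by positivity) (by norm_num)]
    nlinarith
  have hb15 : b ≤ 1 / 15 := by
    rw [hb, div_le_div_iff₀ (by positivity) (by norm_num)]
    linarith
  have key : (t + 6) * p ^ 2 ≤ (1 + b) * (1 + p) := by
    calc (t + 6) * p ^ 2 = (1 + b) * ((t + 2) * p ^ 2) := by
          linear_combination (-(p ^ 2)) * hbt
      _ ≤ _ := by gcongr
  have key2 : ((t + 6) * p ^ 2) ^ 2 < 1 + 2 * δ := by
    have h1 : (1 + b) * (1 + p) ≤ 1 + 16 / 15 * (b + p) := by nlinarith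
    have h2 : b + p ≤ 2 / 15 := by linarith
    calc ((t + 6) * p ^ 2) ^ 2 ≤ (1 + 16 / 15 * (b + p)) ^ 2 := by
          gcongr; exact key.trans h1
      _ < 1 + 3 * (b + p) := by nlinarith
      _ ≤ _ := by linarith
  calc mu p ℋ ≤ (t + 6).choose 2 * p ^ (t + 4) := hsum
    _ ≤ (t + 6) ^ 2 / 2 * p ^ (t + 4) := by gcongr
    _ = ((t + 6) * p ^ 2) ^ 2 / 2 * p ^ t := by rw [pow_add]; ring
    _ < (1 + 2 * δ) / 2 * p ^ t := by gcongr
    _ = _ := by ring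

end Measure

/-! ### Undoing a single shift -/

section Backtracking

variable {n : ℕ}

/-- The sets missing at most `r` elements of `S`. -/
def nearFam (S : Finset (Fin n)) (r : ℕ) : Finset (Finset (Fin n)) :=
  univ.filter fun F => #(S \ F) ≤ r

theorem mem_nearFam {S F : Finset (Fin n)} {r : ℕ} : F ∈ nearFam S r ↔ #(S \ F) ≤ r := by
  simp [nearFam]

variable {𝒢 : Finset (Finset (Fin n))} {i j : Fin n}

theorem mem_shift_or_swapElt_mem_shift (hij : i ≠ j) {A : Finset (Fin n)} (hA : A ∈ 𝒢) :
    A ∈ shift i j 𝒢 ∨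
      (j ∈ A ∧ i ∉ A ∧ swapElt i j A ∉ 𝒢 ∧ swapElt i j A ∈ shift i j 𝒢) := by
  by_cases h : j ∈ A ∧ i ∉ A ∧ swapElt i j A ∉ 𝒢
  · refine Or.inr ⟨h.1, h.2.1, h.2.2, (mem_shift hij).2 (Or.inr ⟨?_, ?_, ?_⟩)⟩
    · simp
    · simp [hij.symm]
    · rwa [swapElt_swapElt hij.symm h.1 h.2.1]
  · refine Or.inl ((mem_shift hij).2 (Or.inl ⟨hA, fun h1 h2 => ?_⟩))
    by_contra h3
    exact h ⟨h1, h2, h3⟩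

/-- Undoing a shift trades `i` for `j`. If `S` contains `j` whenever it contains `i`, this does not
increase the number of missed elements. -/
theorem subset_nearFam_of_shift (hij : i ≠ j) {S : Finset (Fin n)} {r : ℕ}
    (hS : i ∈ S → j ∈ S) (h : shift i j 𝒢 ⊆ nearFam S r) : 𝒢 ⊆ nearFam S r := by
  intro A hA
  rcases mem_shift_or_swapElt_mem_shift hij hA with h1 | ⟨hj, hi, _, h1⟩
  · exact h h1
  · have h2 := mem_nearFam.1 (h h1)
    refine mem_nearFam.2 (le_trans ?_ h2)
    by_cases hiS : i ∈ S
    · have hsub : S \ A ⊆ insert i ((S \ swapElt i j A).erase j) := by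
        intro x hx
        simp only [swapElt, mem_sdiff, mem_insert, mem_erase, mem_union, mem_singleton] at hx ⊢
        grind
      have hjm : j ∈ S \ swapElt i j A := by simp [hS hiS, hij.symm]
      have h3 := card_le_card hsub
      have h4 := card_insert_le i ((S \ swapElt i j A).erase j)
      rw [card_erase_add_one hjm] at h4
      omega
    · refine card_le_card fun x hx => ?_
      simp only [swapElt, mem_sdiff, mem_union, mem_singleton] at hx ⊢
      grind

theorem card_insert_erase {S : Finset (Fin n)} (hi : i ∈ S) (hj : j ∉ S) :
    #(insert j (S.erase i)) = #S := by
  rw [card_insert_of_notMem (fun h => hj (mem_of_mem_erase h)), card_erase_add_one hi]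

/-- If both copies fail, some member avoids `i` and some member avoids `j`, so the complements of
`{i}` and of `{j}` belong to the up-set. The second blocks the shift of the first, which therefore
stays although it misses `i ∈ S`. -/
theorem exists_subset_nearFam_zero (hij : i ≠ j) (hu : IsUp 𝒢) {S : Finset (Fin n)}
    (h : shift i j 𝒢 ⊆ nearFam S 0) : ∃ S', #S' = #S ∧ 𝒢 ⊆ nearFam S' 0 := by
  by_cases hS : i ∈ S → j ∈ S
  · exact ⟨S, rfl, subset_nearFam_of_shift hij hS h⟩
  rw [Classical.not_imp] at hS
  have hsub : ∀ {S F : Finset (Fin n)}, F ∈ nearFam S 0 ↔ S ⊆ F := by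
    intro S F
    rw [mem_nearFam, Nat.le_zero, card_eq_zero, sdiff_eq_empty_iff_subset]
  by_contra! hcon
  obtain ⟨A, hA, hAS⟩ := not_subset.1 (hcon S rfl)
  obtain ⟨B, hB, hBS⟩ := not_subset.1 (hcon _ (card_insert_erase hS.1 hS.2))
  rw [hsub] at hAS hBS
  have hiA : i ∉ A := by
    rcases mem_shift_or_swapElt_mem_shift hij hA with h1 | ⟨_, hi, _⟩
    · exact absurd (hsub.1 (h h1)) hAS
    · exact hi
  have hjB : j ∉ B := by
    intro hjB
    refine hBS fun x hx => ?_
    rcases mem_insert.1 hx with rfl | hx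
    · exact hjB
    obtain ⟨hxi, hxS⟩ := mem_erase.1 hx
    rcases mem_shift_or_swapElt_mem_shift hij hB with h1 | ⟨_, _, _, h1⟩
    · exact hsub.1 (h h1) hxS
    · have := hsub.1 (h h1) hxS
      simp only [swapElt, mem_union, mem_sdiff, mem_singleton] at this
      tauto
  have hA' : ({i}ᶜ : Finset (Fin n)) ∈ 𝒢 := hu A hA _ fun x hx => by
    simp only [mem_compl, mem_singleton]
    exact fun e => hiA (e ▸ hx)
  have hB' : ({j}ᶜ : Finset (Fin n)) ∈ 𝒢 := hu B hB _ fun x hx => by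
    simp only [mem_compl, mem_singleton]
    exact fun e => hjB (e ▸ hx)
  rcases mem_shift_or_swapElt_mem_shift hij hA' with h1 | ⟨_, _, h1, _⟩
  · have := hsub.1 (h h1) hS.1
    simp at this
  · refine h1 (hu _ hB' _ fun x hx => ?_)
    simp only [swapElt, mem_union, mem_sdiff, mem_singleton, mem_compl] at hx ⊢
    tauto

/-- Each such member misses one point of `P`. Two of them with different missed points `a`, `c` meet
`B` inside `P \ {a, c, b}` unless their links meet; that leaves `t - 1` points. So at most one
missed point has a heavy link. -/
theorem mu_side_le {p : ℝ} (h0 : 0 ≤ p) (h1 : p ≤ 1 / 15) {t : ℕ} (ht : 1 ≤ t)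
    (h3 : IsThreeWise t 𝒢) (hu : IsUp 𝒢) {P : Finset (Fin n)} (hij : i ≠ j)
    (hiP : i ∉ P) (hjP : j ∉ P) (hP : #P = t + 2) (hmiss : ∀ A ∈ 𝒢, #(P \ A) ≤ 1)
    (hswap : ∀ A ∈ 𝒢, j ∈ A → i ∉ A → ¬ P ⊆ A → swapElt i j A ∉ 𝒢)
    {B : Finset (Fin n)} (hB : B ∈ 𝒢) (hjB : j ∉ B) (hPB : ¬ P ⊆ B) :
    mu p (𝒢.filter fun F => j ∈ F ∧ i ∉ F ∧ ¬ P ⊆ F) ≤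
      p ^ (t + 2) * (1 - p) * (1 + (t + 3) * (3 / 40)) := by
  obtain ⟨b, hbP, hbB⟩ := not_subset.1 hPB
  have hq : 0 ≤ 1 - p := by linarith
  -- The condition `i ∉ F` would spoil monotonicity of the links; asking for `F.erase i ∈ 𝒢` instead
  -- makes membership insensitive to `i`.
  set 𝒜 : Finset (Finset (Fin n)) := univ.filter fun F => F.erase i ∈ 𝒢 ∧ j ∈ F ∧ ¬ P ⊆ F
    with h𝒜
  have hmem𝒜 : ∀ {F}, F ∈ 𝒜 ↔ F.erase i ∈ 𝒢 ∧ j ∈ F ∧ ¬ P ⊆ F := by simp [h𝒜]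
  have hle : mu p (𝒢.filter fun F => j ∈ F ∧ i ∉ F ∧ ¬ P ⊆ F) ≤ mu p 𝒜 := by
    refine mu_mono h0 (by linarith) fun F hF => ?_
    obtain ⟨hF, hj, hi, hPF⟩ := mem_filter.1 hF
    exact hmem𝒜.2 ⟨by rwa [erase_eq_of_notMem hi], hj, hPF⟩
  obtain ⟨U, hU⟩ : ∃ U, U = insert j P := ⟨_, rfl⟩
  have hUcard : #U = t + 2 + 1 := by rw [hU, card_insert_of_notMem hjP, hP]
  have hUmiss : ∀ F ∈ 𝒜, #(U \ F) = 1 := by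
    intro F hF
    obtain ⟨hF, hj, hPF⟩ := hmem𝒜.1 hF
    have e : U \ F = P \ F.erase i := by
      ext x
      simp only [hU, mem_sdiff, mem_insert, mem_erase]
      grind
    have h4 := hmiss _ hF
    rw [← e] at h4
    obtain ⟨x, hxP, hxF⟩ := not_subset.1 hPF
    have : 0 < #(U \ F) := card_pos.2 ⟨x, mem_sdiff.2 ⟨hU ▸ mem_insert_of_mem hxP, hxF⟩⟩
    omega
  -- the missed element of a member of `𝒜` differs from `b`
  have hne : ∀ {a Y}, U \ {a} ∪ Y ∈ 𝒜 → a ∈ P ∧ a ∉ Y ∧ a ≠ b := by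
    intro a Y hF
    obtain ⟨hF, hj, hPF⟩ := hmem𝒜.1 hF
    obtain ⟨x, hxP, hxF⟩ := not_subset.1 hPF
    simp only [mem_union, mem_sdiff, mem_singleton, not_or, not_and, not_not] at hxF
    obtain rfl := hxF.1 (hU ▸ mem_insert_of_mem hxP)
    refine ⟨hxP, hxF.2, ?_⟩
    rintro rfl
    have hxi : x ≠ i := fun e => hiP (e ▸ hxP)
    have hxj : x ≠ j := fun e => hjP (e ▸ hxP)
    -- If the missed point were `b`, exchanging `j` for `i` in this set would give a superset of
    -- `B`, hence a member, against `hswap`.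
    have hA : ({i, x}ᶜ : Finset (Fin n)) ∈ 𝒢 := hu _ hF _ fun y hy => by
      simp only [mem_erase, mem_union, mem_sdiff, mem_singleton, mem_compl, mem_insert] at hy ⊢
      grind
    refine hswap _ hA (by simp [hij.symm, hxj.symm]) (by simp)
      (fun hsub => by simpa using hsub hxP) (hu _ hB _ fun y hy => ?_)
    simp only [swapElt, mem_union, mem_sdiff, mem_singleton, mem_compl, mem_insert]
    grind
  have hcross : ∀ M ∈ U.powersetCard 1, ∀ M' ∈ U.powersetCard 1, Disjoint M M' →
      prob p Uᶜ (fun Y => (U \ M) ∪ Y ∈ 𝒜) ≤ 3 / 40 ∨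
      prob p Uᶜ (fun Y => (U \ M') ∪ Y ∈ 𝒜) ≤ 3 / 40 := by
    intro M hM M' hM' hd
    obtain ⟨a, rfl⟩ := card_eq_one.1 (mem_powersetCard.1 hM).2
    obtain ⟨c, rfl⟩ := card_eq_one.1 (mem_powersetCard.1 hM').2
    have hac : a ≠ c := by simpa using hd
    refine prob_min_of_cross h0 h1 ?_ ?_
    · intro Y Z hYZ hZ hY
      have hsub : U \ {a} ∪ Y ⊆ U \ {a} ∪ Z := union_subset_union_right hYZ
      obtain ⟨haP, _⟩ := hne hY
      obtain ⟨hF, hj, _⟩ := hmem𝒜.1 hY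
      refine hmem𝒜.2 ⟨hu _ hF _ (erase_subset_erase _ hsub), hsub hj, fun hPF => ?_⟩
      have := hPF haP
      simp only [mem_union, mem_sdiff, mem_singleton, not_true, and_false, false_or] at this
      exact mem_compl.1 (hZ this) (hU ▸ mem_insert_of_mem haP)
    · intro Y Z hY hZ hF hF'
      by_contra hemp
      rw [not_nonempty_iff_eq_empty] at hemp
      obtain ⟨haP, _, hab⟩ := hne hF
      obtain ⟨hcP, _, hcb⟩ := hne hF'
      have h4 := h3 _ (hmem𝒜.1 hF).1 _ (hmem𝒜.1 hF').1 _ hB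
      have hsub : (U \ {a} ∪ Y).erase i ∩ (U \ {c} ∪ Z).erase i ∩ B ⊆ P \ {a, c, b} := by
        intro x hx
        simp only [mem_inter, mem_erase, mem_union, mem_sdiff, mem_singleton, mem_insert] at hx ⊢
        obtain ⟨⟨⟨_, h5⟩, ⟨_, h6⟩⟩, h7⟩ := hx
        have e1 : x ∈ Y → x ∉ U := fun hx => mem_compl.1 (hY hx)
        have e2 : x ∈ Z → x ∉ U := fun hx => mem_compl.1 (hZ hx)
        have e3 : ¬ (x ∈ Y ∧ x ∈ Z) := fun h => by
          have := mem_inter.2 h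
          simp [hemp] at this
        have e4 : x ∈ U → x ∈ P := by
          rw [hU, mem_insert]
          rintro (rfl | h)
          · exact absurd h7 hjB
          · exact h
        grind
      have h5 := card_le_card hsub
      have h6 : #({a, c, b} : Finset (Fin n)) = 3 := card_eq_three.2 ⟨a, c, b, hac, hab, hcb, rfl⟩
      rw [card_sdiff_of_subset (by simp [insert_subset_iff, haP, hcP, hbP]), h6, hP] at h5
      omega
  refine hle.trans ?_
  rw [mu_eq_sum_missing p hUcard hUmiss, pow_one]
  gcongr
  have key := sum_le_of_card_filter (U.powersetCard 1)
    (fun M => prob p Uᶜ (fun Y => (U \ M) ∪ Y ∈ 𝒜)) (c := 3 / 40) (e := 1) (by norm_num)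
    (fun M _ => prob_le_one h0 (by linarith)) ?_
  · rw [card_powersetCard, hUcard, Nat.choose_one_right] at key
    push_cast at key
    linarith
  · have := card_le_interBound (i := 1) (by norm_num) (filter_subset (fun M => (3 / 40 : ℝ) <
      prob p Uᶜ (fun Y => (U \ M) ∪ Y ∈ 𝒜)) (U.powersetCard 1)) ?_
    · exact_mod_cast this
    · intro M hM M' hM' hd
      rw [mem_filter] at hM hM'
      rcases hcross M hM.1 M' hM'.1 hd with h | h
      · exact absurd hM.2 (not_lt.2 h)
      · exact absurd hM'.2 (not_lt.2 h)

/-- Write `P = S \ {i}`. If both copies fail, the witnesses miss `i`, respectively `j`, together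
with a point of `P`. Members not containing `P` hold `i` or `j`: those with exactly one are bounded
by `mu_side_le` on either side, those with both carry an extra factor `p`. -/
theorem exists_subset_nearFam_one {t : ℕ} (ht : 241 ≤ t) {p : ℝ} (hp : 0 < p)
    (hpt : (t + 2) * p ^ 2 ≤ 1 + p) (hij : i ≠ j) (h3 : IsThreeWise t 𝒢) (hu : IsUp 𝒢)
    {S : Finset (Fin n)} (hS : #S = t + 3) (h : shift i j 𝒢 ⊆ nearFam S 1) :
    mu p 𝒢 < 1 / 2 * p ^ t ∨ ∃ S', #S' = #S ∧ 𝒢 ⊆ nearFam S' 1 := by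
  by_cases hijS : i ∈ S → j ∈ S
  · exact Or.inr ⟨S, rfl, subset_nearFam_of_shift hij hijS h⟩
  rw [Classical.not_imp] at hijS
  obtain ⟨hiS, hjS⟩ := hijS
  refine or_iff_not_imp_right.2 fun hcon => ?_
  push Not at hcon
  obtain ⟨A₀, hA₀, hA₀S⟩ := not_subset.1 (hcon S rfl)
  obtain ⟨B₀, hB₀, hB₀S⟩ := not_subset.1 (hcon _ (card_insert_erase hiS hjS))
  obtain ⟨P, hP⟩ : ∃ P, P = S.erase i := ⟨_, rfl⟩
  have hiP : i ∉ P := by simp [hP]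
  have hjP : j ∉ P := by simp [hP, hjS]
  have hPS : S = insert i P := by rw [hP, insert_erase hiS]
  have hPcard : #P = t + 2 := by rw [hP, card_erase_of_mem hiS, hS]; rfl
  rw [← hP] at hB₀S
  have hmiss : ∀ A ∈ 𝒢, #(P \ A) ≤ 1 := by
    intro A hA
    rcases mem_shift_or_swapElt_mem_shift hij hA with h1 | ⟨_, _, _, h1⟩
    · refine (card_le_card ?_).trans (mem_nearFam.1 (h h1))
      rw [hPS]
      exact sdiff_subset_sdiff (subset_insert _ _) le_rfl
    · refine (card_le_card fun x hx => ?_).trans (mem_nearFam.1 (h h1))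
      simp only [hPS, swapElt, mem_sdiff, mem_insert, mem_union, mem_singleton] at hx ⊢
      grind
  have hshift : ∀ A ∈ shift i j 𝒢, i ∉ A → P ⊆ A := by
    intro A hA hi x hxP
    by_contra hxA
    have h1 : ({i, x} : Finset (Fin n)) ⊆ S \ A := by
      simp [insert_subset_iff, hPS, hi, hxA, hxP]
    have h2 := (card_le_card h1).trans (mem_nearFam.1 (h hA))
    rw [card_pair (by rintro rfl; exact hiP hxP)] at h2
    omega
  have hswap : ∀ A ∈ 𝒢, j ∈ A → i ∉ A → ¬ P ⊆ A → swapElt i j A ∉ 𝒢 := by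
    intro A hA hj hi hPA
    rcases mem_shift_or_swapElt_mem_shift hij hA with h1 | ⟨_, _, h1, _⟩
    · exact absurd (hshift A h1 hi) hPA
    · exact h1
  have hswap' : ∀ A ∈ 𝒢, i ∈ A → j ∉ A → ¬ P ⊆ A → swapElt j i A ∉ 𝒢 := by
    intro A hA hi hj hPA hA'
    refine hswap _ hA' (by simp) (by simp [hij]) (fun hsub => hPA fun x hx => ?_) ?_
    · have := hsub hx
      simp only [swapElt, mem_union, mem_sdiff, mem_singleton] at this
      grind
    · rwa [swapElt_swapElt hij hi hj]
  have hnone : ∀ A ∈ 𝒢, i ∉ A → j ∉ A → P ⊆ A := by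
    intro A hA hi hj
    rcases mem_shift_or_swapElt_mem_shift hij hA with h1 | ⟨hj', _⟩
    · exact hshift A h1 hi
    · exact absurd hj' hj
  have hfact : ∀ {x : Fin n} {A : Finset (Fin n)}, A ∈ 𝒢 → 1 < #(insert x P \ A) →
      x ∉ A ∧ ¬ P ⊆ A := by
    intro x A hA hcard
    constructor
    · intro hx
      rw [insert_sdiff_of_mem _ hx] at hcard
      have := hmiss A hA
      omega
    · intro hPA
      have : insert x P \ A ⊆ {x} := by
        intro y hy
        simp only [mem_sdiff, mem_insert, mem_singleton] at hy ⊢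
        exact hy.1.resolve_right fun h => hy.2 (hPA h)
      have := card_le_card this
      simp at this
      omega
  rw [mem_nearFam, not_le] at hA₀S hB₀S
  rw [hPS] at hA₀S
  obtain ⟨hiA, hPA⟩ := hfact hA₀ hA₀S
  obtain ⟨hjB, hPB⟩ := hfact hB₀ hB₀S
  have h15 := le_one_div_of_mul_sq_le ht hp hpt
  have hq : 0 ≤ 1 - p := by linarith
  have b1 := mu_side_le hp.le h15 (by omega) h3 hu hij hiP hjP hPcard hmiss hswap hB₀ hjB hPB
  have b2 := mu_side_le hp.le h15 (by omega) h3 hu hij.symm hjP hiP hPcard hmiss hswap' hA₀ hiA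
    hPA
  have b3 : mu p (𝒢.filter fun F => P ⊆ F) ≤ p ^ (t + 2) := by
    have := mu_le_choose hp.le (by linarith) (𝒜 := 𝒢.filter fun F => P ⊆ F) (i := 0)
      (k := t + 2) hPcard
      (fun F hF => by rw [sdiff_eq_empty_iff_subset.2 (mem_filter.1 hF).2, card_empty])
    simpa using this
  have b4 : mu p (𝒢.filter fun F => i ∈ F ∧ j ∈ F ∧ ¬ P ⊆ F) ≤
      p ^ (t + 3) * (1 - p) * (t + 4) := by
    have := mu_le_choose hp.le (by linarith)
      (𝒜 := 𝒢.filter fun F => i ∈ F ∧ j ∈ F ∧ ¬ P ⊆ F) (i := 1)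
      (k := t + 3) (U := insert j S) (by rw [card_insert_of_notMem hjS, hS]) ?_
    · rw [Nat.choose_one_right, pow_one] at this
      push_cast at this
      linarith
    · intro F hF
      obtain ⟨hF, hi, hj, hPF⟩ := mem_filter.1 hF
      have e : insert j S \ F = P \ F := by
        ext x
        simp only [hPS, mem_sdiff, mem_insert]
        grind
      obtain ⟨x, hxP, hxF⟩ := not_subset.1 hPF
      have : 0 < #(P \ F) := card_pos.2 ⟨x, mem_sdiff.2 ⟨hxP, hxF⟩⟩
      rw [e]
      have := hmiss F hF
      omega
  have hcover := mu_le_sum_of_cover hp.le (by linarith) (univ : Finset (Fin 4)) (𝒢 := 𝒢)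
    ![𝒢.filter fun F => j ∈ F ∧ i ∉ F ∧ ¬ P ⊆ F, 𝒢.filter fun F => i ∈ F ∧ j ∉ F ∧ ¬ P ⊆ F,
      𝒢.filter fun F => P ⊆ F, 𝒢.filter fun F => i ∈ F ∧ j ∈ F ∧ ¬ P ⊆ F] (by
    intro F hF
    by_cases hPF : P ⊆ F
    · exact ⟨2, mem_univ _, mem_filter.2 ⟨hF, hPF⟩⟩
    by_cases hi : i ∈ F <;> by_cases hj : j ∈ F
    · exact ⟨3, mem_univ _, mem_filter.2 ⟨hF, hi, hj, hPF⟩⟩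
    · exact ⟨1, mem_univ _, mem_filter.2 ⟨hF, hi, hj, hPF⟩⟩
    · exact ⟨0, mem_univ _, mem_filter.2 ⟨hF, hj, hi, hPF⟩⟩
    · exact absurd (hnone F hF hi hj) hPF)
  rw [Fin.sum_univ_four] at hcover
  have hcover' : mu p 𝒢 ≤ p ^ (t + 2) * (1 - p) * (1 + (t + 3) * (3 / 40)) +
      p ^ (t + 2) * (1 - p) * (1 + (t + 3) * (3 / 40)) + p ^ (t + 2) +
      p ^ (t + 3) * (1 - p) * (t + 4) :=
    hcover.trans (add_le_add (add_le_add (add_le_add b1 b2) b3) b4)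
  have htr : (241 : ℝ) ≤ t := by exact_mod_cast ht
  obtain ⟨v, hv⟩ : ∃ v, v = p ^ 2 * (1 - p) := ⟨_, rfl⟩
  have hv0 : 0 ≤ v := by rw [hv]; positivity
  have hv1 : (t + 2) * v ≤ 1 := hv ▸ mul_sq_mul_le_one (by linarith) hpt
  have hv2 : v ≤ 1 / 243 := by rw [le_div_iff₀ (by norm_num)]; nlinarith
  have hp2 : p ^ 2 ≤ 1 / 225 := by nlinarith
  have hpv : p * ((t + 4) * v) ≤ 1 / 15 * (1 + 2 / 243) :=
    mul_le_mul h15 (by linarith) (by positivity) (by norm_num)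
  have hpt0 : 0 < p ^ t := by positivity
  -- The main terms are `3/20` from the two sides and `1/15` from the members holding both `i` and
  -- `j`.
  calc mu p 𝒢 ≤ _ := hcover'
    _ = (2 * v + (t + 3) * v * (3 / 20) + p ^ 2 + p * ((t + 4) * v)) * p ^ t := by
      rw [hv, pow_add, pow_add]; ring
    _ < 1 / 2 * p ^ t := by
      gcongr
      linarith

end Backtracking

/-! ### Isomorphic copies and chains of shifts -/

section Isomorphism

variable {n : ℕ}

theorem fam_eq_nearFam {t r : ℕ} (hn : t + 3 * r ≤ n) :
    fam n t r = nearFam (seg n (t + 3 * r)) r := by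
  ext F
  have := card_seg_sdiff hn F
  simp only [fam, nearFam, mem_filter, mem_univ, true_and]
  omega

theorem exists_perm_image_eq {S T : Finset (Fin n)} (h : #S = #T) :
    ∃ τ : Equiv.Perm (Fin n), S.image τ = T := by
  let e : {x // x ∈ S} ≃ {x // x ∈ T} := equivOfCardEq h
  refine ⟨e.extendSubtype, eq_of_subset_of_card_le ?_ ?_⟩
  · intro y hy
    obtain ⟨x, hx, rfl⟩ := mem_image.1 hy
    exact e.extendSubtype_mem x hx
  · rw [card_image_of_injective _ e.extendSubtype.injective, h]

theorem iso_nearFam {S T : Finset (Fin n)} (h : #S = #T) (r : ℕ) :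
    Iso (nearFam S r) (nearFam T r) := by
  obtain ⟨τ, rfl⟩ := exists_perm_image_eq h
  have hc : ∀ F : Finset (Fin n), #(S.image τ \ F.image τ) = #(S \ F) := fun F => by
    rw [← image_sdiff _ _ τ.injective, card_image_of_injective _ τ.injective]
  refine ⟨τ, ?_⟩
  ext F
  simp only [mem_image, mem_nearFam]
  constructor
  · intro hF
    have e : (F.image τ.symm).image τ = F := by simp [image_image]
    refine ⟨F.image τ.symm, ?_, e⟩
    rw [← hc, e]
    exact hF
  · rintro ⟨G, hG, rfl⟩
    rwa [hc]

/-- The properties of a family preserved by shifting. -/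
theorem shifting_invariants {t : ℕ} {p : ℝ} {𝒢 ℋ : Finset (Finset (Fin n))}
    (h : Relation.ReflTransGen (fun 𝒜 ℬ => ∃ i j : Fin n, i < j ∧ ℬ = shift i j 𝒜) 𝒢 ℋ)
    (h3 : IsThreeWise t 𝒢) (hu : IsUp 𝒢) :
    IsThreeWise t ℋ ∧ IsUp ℋ ∧ mu p ℋ = mu p 𝒢 := by
  induction h with
  | refl => exact ⟨h3, hu, rfl⟩
  | tail _ hstep ih =>
    obtain ⟨i, j, hij, rfl⟩ := hstep
    exact ⟨ih.1.shift hij.ne, ih.2.1.shift hij.ne, (mu_shift hij.ne p).trans ih.2.2⟩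

/-- A family that shifts into `𝓕_0^t` or `𝓕_1^t` lies in an isomorphic copy, unless it has
small measure. -/
theorem exists_subset_nearFam {t r : ℕ} (hr : r = 0 ∨ r = 1) (ht : 241 ≤ t) {p : ℝ} (hp : 0 < p)
    (hpt : (t + 2) * p ^ 2 ≤ 1 + p) {𝒢 ℋ : Finset (Finset (Fin n))}
    (h : Relation.ReflTransGen (fun 𝒜 ℬ => ∃ i j : Fin n, i < j ∧ ℬ = shift i j 𝒜) 𝒢 ℋ)
    (h3 : IsThreeWise t 𝒢) (hu : IsUp 𝒢) {S : Finset (Fin n)} (hS : #S = t + 3 * r)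
    (hℋ : ℋ ⊆ nearFam S r) :
    mu p 𝒢 < 1 / 2 * p ^ t ∨ ∃ S' : Finset (Fin n), #S' = t + 3 * r ∧ 𝒢 ⊆ nearFam S' r := by
  -- The chain is undone from its shifted end. The set `S` may change at each step while its size
  -- does not, and a small measure passes back since shifts preserve `mu`.
  induction h using Relation.ReflTransGen.head_induction_on with
  | refl => exact Or.inr ⟨S, hS, hℋ⟩
  | head hstep _ ih =>
    obtain ⟨i, j, hij, rfl⟩ := hstep
    rcases ih (h3.shift hij.ne) (hu.shift hij.ne) with h1 | ⟨S', hS', h1⟩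
    · rw [mu_shift hij.ne] at h1
      exact Or.inl h1
    · rcases hr with rfl | rfl
      · obtain ⟨S'', hS'', h2⟩ := exists_subset_nearFam_zero hij.ne hu h1
        exact Or.inr ⟨S'', hS''.trans hS', h2⟩
      · rcases exists_subset_nearFam_one ht hp hpt hij.ne h3 hu hS' h1 with h2 | ⟨S'', hS'', h2⟩
        · exact Or.inl h2
        · exact Or.inr ⟨S'', hS''.trans hS', h2⟩

end Isomorphism

end ThreeWise

open ThreeWise

theorem mainTheorem2 :
    ∃ t₀ : ℝ → ℕ, ∀ t : ℕ, 241 ≤ t → ∀ p : ℝ, 0 < p → p ≤ ThreeWise.p₀ t →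
      ∀ (n : ℕ) (𝒢 : Finset (Finset (Fin n))), ThreeWise.IsThreeWise t 𝒢 →
        ThreeWise.mu p 𝒢 < 1 / 2 * p ^ t ∨
        (∃ i : ℕ, (i = 0 ∨ i = 1) ∧ t + 3 * i ≤ n ∧
          ∃ 𝓕 : Finset (Finset (Fin n)), ThreeWise.Iso 𝓕 (ThreeWise.fam n t i) ∧ 𝒢 ⊆ 𝓕) ∨
        ((t + 3 * 2 ≤ n ∧
          ∃ 𝒢' ℋ : Finset (Finset (Fin n)), 𝒢 ⊆ 𝒢' ∧ ThreeWise.IsMaximal t 𝒢' ∧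
            ThreeWise.ObtainedByShifting 𝒢' ℋ ∧ ℋ ⊆ ThreeWise.fam n t 2) ∧
          ∀ δ : ℝ, 0 < δ → t₀ δ < t → ThreeWise.mu p 𝒢 < (1 / 2 + δ) * p ^ t) := by
  -- The two summands force `p ≤ δ / 3` and `4 / (t + 2) ≤ δ / 3` in `mu_lt_of_subset_fam_two`.
  refine ⟨fun δ => ⌈18 / δ ^ 2 + 12 / δ⌉₊, fun t ht p hp hp₀ n 𝒢 h𝒢 => ?_⟩
  have hpt := mul_sq_le_of_le_p₀ ht hp hp₀
  have h15 := le_one_div_of_mul_sq_le ht hp hpt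
  obtain ⟨𝒢', hsub, hmax⟩ := exists_isMaximal h𝒢
  obtain ⟨ℋ, hℋ⟩ := exists_obtainedByShifting 𝒢'
  obtain ⟨h3, hu, hmu⟩ := shifting_invariants (p := p) hℋ.1 hmax.1 hmax.isUp
  have hle : mu p 𝒢 ≤ mu p 𝒢' := mu_mono hp.le (by linarith) hsub
  have hlow : ∀ r, r = 0 ∨ r = 1 → t + 3 * r ≤ n → ℋ ⊆ fam n t r →
      mu p 𝒢 < 1 / 2 * p ^ t ∨ ∃ i : ℕ, (i = 0 ∨ i = 1) ∧ t + 3 * i ≤ n ∧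
        ∃ 𝓕 : Finset (Finset (Fin n)), Iso 𝓕 (fam n t i) ∧ 𝒢 ⊆ 𝓕 := by
    intro r hr hn hfam
    rw [fam_eq_nearFam hn] at hfam
    rcases exists_subset_nearFam hr ht hp hpt hℋ.1 hmax.1 hmax.isUp (card_seg hn) hfam with
      h1 | ⟨S, hS, h1⟩
    · exact Or.inl (hle.trans_lt h1)
    · refine Or.inr ⟨r, hr, hn, nearFam S r, ?_, hsub.trans h1⟩
      rw [fam_eq_nearFam hn]
      exact iso_nearFam (hS.trans (card_seg hn).symm) r
  by_cases c0 : t + 3 * 0 ≤ n ∧ ℋ ⊆ fam n t 0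
  · exact (hlow 0 (Or.inl rfl) c0.1 c0.2).imp_right Or.inl
  by_cases c1 : t + 3 * 1 ≤ n ∧ ℋ ⊆ fam n t 1
  · exact (hlow 1 (Or.inr rfl) c1.1 c1.2).imp_right Or.inl
  by_cases c2 : t + 3 * 2 ≤ n ∧ ℋ ⊆ fam n t 2
  · refine Or.inr (Or.inr ⟨⟨c2.1, 𝒢', ℋ, hsub, hmax, hℋ, c2.2⟩, fun δ hδ htδ => ?_⟩)
    rw [← hmu] at hle
    exact hle.trans_lt (mu_lt_of_subset_fam_two ht c2.1 hp hpt c2.2 hδ (Nat.lt_of_ceil_lt htδ))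
  · refine Or.inl ?_
    rw [← hmu] at hle
    refine hle.trans_lt (mu_lt_of_shifted ht hp hpt h3 hℋ.2 hu fun i hi hn hfam => ?_)
    interval_cases i
    · exact c0 ⟨hn, hfam⟩
    · exact c1 ⟨hn, hfam⟩
    · exact c2 ⟨hn, hfam⟩
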